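/- **Setting.** Let $\mathbb F\in\{\mathbb R,\mathbb C\}$ and let $A,B\in\mathbb F^{n\times n}$ form a singular pencil, i.e. $\det(A-\lambda B)\equiv 0$. Put $\operatorname{nrank}(A,B)=\max_{\zeta\in\mathbb C}\operatorname{rank}(A-\zeta B)$ and $k=n-\operatorname{nrank}(A,B)\ge 1$. Let $\lambda_i\in\mathbb F$ be a finite simple eigenvalue of $A-\lambda B$, that is, $\operatorname{rank}(A-\lambda_iB)<\operatorname{nrank}(A,B)$ and $\lambda_i$ is a simple root of $\det R(\lambda)$, where $R(\lambda)$ is the regular part of the (complex) Kronecker canonical form of $A-\lambda B$. Let $\mathcal M$ be the minimal reducing subspace of the pencil, i.e. the intersection of all subspaces $\mathcal S\subseteq\mathbb C^n$ with $\dim(A\mathcal S+B\mathcal S)=\dim\mathcal S-k$. Let $\mathcal L$ be the minimal left reducing subspace, defined in the same way from $A^*,B^*$. Let $[X_1\ x],[Y_1\ y]\in\mathbb F^{n\times(k+1)}$ have orthonormal columns such that, over $\mathbb C$, - the columns of $[X_1\ x]$ form a basis of $\ker(A-\lambda_iB)$, and those of $X_1\in\mathbb F^{n\times k}$ a basis of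 $\ker(A-\lambda_iB)\cap\mathcal M$; - the columns of $[Y_1\ y]$ form a basis of $\ker((A-\lambda_iB)^*)$, and those of $Y_1\in\mathbb F^{n\times k}$ a basis of $\ker((A-\lambda_iB)^*)\cap\mathcal L$. Let $U,V$ be independent random matrices, each uniformly distributed on the Stiefel manifold $\{Q\in\mathbb F^{n\times k}:Q^*Q=I\}$. Let $0\ne\tau\in\mathbb F$, and let $D_A,D_B\in\mathbb F^{k\times k}$ be (deterministic or random) diagonal matrices such that almost surely $\det(D_A-\lambda_iD_B)\neq0$. Let $x_i,y_i\in\mathbb F^n$ be right and left eigenvectors, with $\|x_i\|_2=\|y_i\|_2=1$, of the perturbed pencil $$\widetilde A-\lambda\widetilde B=A-\lambda B+\tau\,(UD_AV^*-\lambda\,UD_BV^*)$$ for the eigenvalue $\lambda_i$. Let $\alpha=x^*x_i$ and $\beta=y^*y_i$, written $\alpha_{\mathbb F},\beta_{\mathbb F}$. **Lemma 4.6.** Almost surely $V^*x_i=0$, $U^*y_i=0$, $x_i=X_1a+\alpha x$ and $y_i=Y_1b+\beta y$ for some $a,b\in\mathbb F^k$, so $\alpha,\beta$ are the coordinates of $x_i,y_i$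 along $x,y$. The random variables $|\alpha|$, $|\beta|$ and $|\alpha||\beta|$ are integrable, and the following holds. a) For $\mathbb F=\mathbb C$: $$\mathbb E[|\alpha_{\mathbb C}|]=\mathbb E[|\beta_{\mathbb C}|]=\frac{\sqrt\pi\,\Gamma(k+1)}{2\,\Gamma(k+3/2)},\qquad \mathbb E[|\alpha_{\mathbb C}||\beta_{\mathbb C}|]=\frac{\pi\,\Gamma(k+1)^2}{4\,\Gamma(k+3/2)^2},$$ $$\frac{\pi}{4(k+1)}\le\mathbb E[|\alpha_{\mathbb C}||\beta_{\mathbb C}|]\le\frac{\pi}{4(k+1/2)}.$$ b) For $\mathbb F=\mathbb R$: $$\mathbb E[|\alpha_{\mathbb R}|]=\mathbb E[|\beta_{\mathbb R}|]=\frac{\Gamma((k+1)/2)}{\sqrt\pi\,\Gamma((k+2)/2)},\qquad \mathbb E[|\alpha_{\mathbb R}||\beta_{\mathbb R}|]=\frac{\Gamma((k+1)/2)^2}{\pi\,\Gamma((k+2)/2)^2},$$ $$\frac{2}{\pi(k+1)}\le\mathbb E[|\alpha_{\mathbb R}||\beta_{\mathbb R}|]\le\frac{2}{\pi k}.$$ 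-/

import Mathlib

open MeasureTheory ProbabilityTheory Polynomial

namespace SingularPencil

/-! ### Deterministic theory of matrix pencils over the complex numbers -/

/-- The normal rank of the pencil `A - λ B`: the maximum over `ζ` in `ℂ` of `rank (A - ζ B)`.
(The set of these ranks is a nonempty bounded set of natural numbers, so the supremum is a
maximum.) -/
noncomputable def normalRank {n : ℕ} (A B : Matrix (Fin n) (Fin n) ℂ) : ℕ :=
  ⨆ ζ : ℂ, (A - ζ • B).rank

/-- The pencil `A - λ B` is singular: `det (A - λ B)` vanishes identically. -/
def IsSingular {n : ℕ} (A B : Matrix (Fin n) (Fin n) ℂ) : Prop :=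
  ∀ ζ : ℂ, (A - ζ • B).det = 0

/-- A finite eigenvalue of the (possibly singular) pencil `A - λ B`: the rank drops below the
normal rank. -/
def IsEigenvalue {n : ℕ} (A B : Matrix (Fin n) (Fin n) ℂ) (lam : ℂ) : Prop :=
  (A - lam • B).rank < normalRank A B

/-- A matrix pencil `A - λ B` as a matrix with polynomial entries in the variable `λ`. -/
noncomputable def pencil {l m : Type*} (A B : Matrix l m ℂ) : Matrix l m ℂ[X] :=
  A.map C - (X : ℂ[X]) • B.map C

/-- The Kronecker block `L_j(λ) = [0 I_j] - λ [I_j 0]` of size `j × (j + 1)`. -/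
noncomputable def kroneckerBlock (j : ℕ) : Matrix (Fin j) (Fin (j + 1)) ℂ[X] :=
  pencil (Matrix.of fun p q => if q = p.succ then 1 else 0)
    (Matrix.of fun p q => if q = p.castSucc then 1 else 0)

/-- A square matrix is in Jordan canonical form: it is upper bidiagonal, its superdiagonal entries
are `0` or `1`, and the two diagonal entries next to a superdiagonal entry `1` agree. -/
def IsJordanForm {r : ℕ} (J : Matrix (Fin r) (Fin r) ℂ) : Prop :=
  (∀ p q : Fin r, (q : ℕ) ≠ p → (q : ℕ) ≠ p + 1 → J p q = 0) ∧
    ∀ p q : Fin r, (q : ℕ) = p + 1 → J p q = 0 ∨ (J p q = 1 ∧ J p p = J q q)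

/-- A Kronecker canonical form of the pencil `A - λ B`:
`P (A - λ B) Q = diag (R(λ), S(λ))` with the regular part `R(λ) = diag (J - λ I_r, I_s - λ N)` and
the singular part
`S(λ) = diag (L_{m_1}(λ), …, L_{m_k}(λ), L_{n_1}(λ)ᵀ, …, L_{n_k}(λ)ᵀ)`.
The bijections `rowEquiv` and `colEquiv` only number the rows and columns of the block matrix. -/
structure KroneckerForm {n : ℕ} (A B : Matrix (Fin n) (Fin n) ℂ) where
  r : ℕ
  s : ℕ
  k : ℕ
  J : Matrix (Fin r) (Fin r) ℂ
  N : Matrix (Fin s) (Fin s) ℂ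
  jordan_J : IsJordanForm J
  jordan_N : IsJordanForm N
  nilpotent_N : IsNilpotent N
  /-- right minimal indices -/
  rightIndex : Fin k → ℕ
  /-- left minimal indices -/
  leftIndex : Fin k → ℕ
  P : Matrix (Fin n) (Fin n) ℂ
  Q : Matrix (Fin n) (Fin n) ℂ
  isUnit_P : IsUnit P
  isUnit_Q : IsUnit Q
  rowEquiv : (Fin r ⊕ Fin s) ⊕ ((Σ i, Fin (rightIndex i)) ⊕ (Σ i, Fin (leftIndex i + 1))) ≃ Fin n
  colEquiv : (Fin r ⊕ Fin s) ⊕ ((Σ i, Fin (rightIndex i + 1)) ⊕ (Σ i, Fin (leftIndex i))) ≃ Fin n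
  form : P.map C * pencil A B * Q.map C =
    Matrix.reindex rowEquiv colEquiv
      (Matrix.fromBlocks
        (Matrix.fromBlocks (pencil J 1) 0 0 (pencil 1 N)) 0 0
        (Matrix.fromBlocks
          (Matrix.blockDiagonal' fun i => kroneckerBlock (rightIndex i)) 0 0
          (Matrix.blockDiagonal' fun i => (kroneckerBlock (leftIndex i)).transpose)))

/-- The regular part `R(λ) = diag (J - λ I_r, I_s - λ N)` of a Kronecker canonical form. -/
noncomputable def KroneckerForm.regularPart {n : ℕ} {A B : Matrix (Fin n) (Fin n) ℂ}
    (K : KroneckerForm A B) : Matrix (Fin K.r ⊕ Fin K.s) (Fin K.r ⊕ Fin K.s) ℂ[X] :=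
  Matrix.fromBlocks (pencil K.J 1) 0 0 (pencil 1 K.N)

/-- A finite eigenvalue is simple if it is a simple root of the determinant of the regular part. -/
def IsSimpleEigenvalue {n : ℕ} (A B : Matrix (Fin n) (Fin n) ℂ) (lam : ℂ) : Prop :=
  IsEigenvalue A B lam ∧ ∃ K : KroneckerForm A B, K.regularPart.det.rootMultiplicity lam = 1

/-- A reducing subspace `M` of the pencil `A - λ B`: `dim (A M + B M) = dim M - k`, where
`k = n - nrank (A, B)`. -/
def IsReducing {n : ℕ} (A B : Matrix (Fin n) (Fin n) ℂ) (M : Submodule ℂ (Fin n → ℂ)) : Prop :=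
  Module.finrank ℂ (M.map A.mulVecLin ⊔ M.map B.mulVecLin : Submodule ℂ (Fin n → ℂ)) +
    (n - normalRank A B) = Module.finrank ℂ M

/-- The minimal reducing subspace: the intersection of all reducing subspaces. The minimal left
reducing subspace of `A - λ B` is the minimal reducing subspace of `Aᴴ - λ Bᴴ`. -/
noncomputable def minimalReducing {n : ℕ} (A B : Matrix (Fin n) (Fin n) ℂ) :
    Submodule ℂ (Fin n → ℂ) :=
  sInf {M | IsReducing A B M}

/-! ### The setting over `𝕜 = ℝ` or `𝕜 = ℂ` -/

/-- A real or complex matrix, viewed as a complex matrix. -/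
noncomputable def toC {𝕜 : Type*} [RCLike 𝕜] {l m : Type*} (M : Matrix l m 𝕜) : Matrix l m ℂ :=
  M.map (RCLike.map 𝕜 ℂ)

/-- The matrix `[M v]`: the column `v` is appended to the matrix `M`. -/
def appendCol {𝕜 : Type*} {l m : Type*} (M : Matrix l m 𝕜) (v : l → 𝕜) :
    Matrix l (m ⊕ Unit) 𝕜 :=
  Matrix.fromCols M (Matrix.replicateCol Unit v)

/-- An `n × n` singular pencil `A - λ B` of normal rank `n - k`, with entries in `𝕜`, a finite
simple eigenvalue `lam` in `𝕜`, and orthonormal bases (with entries in `𝕜`) `[X₁ x]` of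
`ker (A - lam B)` and `[Y₁ y]` of `ker (A - lam B)ᴴ` such that the columns of `X₁` and `Y₁` are
bases of the intersections of these kernels with the minimal reducing subspace and the minimal left
reducing subspace. All notions for the pencil are those of the complex pencil; the range of
`mulVecLin` is the column space. -/
structure SimpleEigenvalueData (𝕜 : Type*) [RCLike 𝕜] (n k : ℕ) where
  A : Matrix (Fin n) (Fin n) 𝕜
  B : Matrix (Fin n) (Fin n) 𝕜
  lam : 𝕜
  singular : IsSingular (toC A) (toC B)
  normalRank_eq : normalRank (toC A) (toC B) + k = n
  simple : IsSimpleEigenvalue (toC A) (toC B) (RCLike.map 𝕜 ℂ lam)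
  X₁ : Matrix (Fin n) (Fin k) 𝕜
  x : Fin n → 𝕜
  Y₁ : Matrix (Fin n) (Fin k) 𝕜
  y : Fin n → 𝕜
  orthonormal_X : (appendCol X₁ x).conjTranspose * appendCol X₁ x = 1
  orthonormal_Y : (appendCol Y₁ y).conjTranspose * appendCol Y₁ y = 1
  range_X : LinearMap.range (toC (appendCol X₁ x)).mulVecLin =
    LinearMap.ker (toC (A - lam • B)).mulVecLin
  range_X₁ : LinearMap.range (toC X₁).mulVecLin =
    LinearMap.ker (toC (A - lam • B)).mulVecLin ⊓ minimalReducing (toC A) (toC B)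
  range_Y : LinearMap.range (toC (appendCol Y₁ y)).mulVecLin =
    LinearMap.ker (toC (A - lam • B)).conjTranspose.mulVecLin
  range_Y₁ : LinearMap.range (toC Y₁).mulVecLin =
    LinearMap.ker (toC (A - lam • B)).conjTranspose.mulVecLin ⊓
      minimalReducing (toC A).conjTranspose (toC B).conjTranspose

/-- Matrices carry the product σ-algebra of their entries. -/
instance instMeasurableSpaceMatrix {l m 𝕜 : Type*} [MeasurableSpace 𝕜] :
    MeasurableSpace (Matrix l m 𝕜) :=
  inferInstanceAs (MeasurableSpace (l → m → 𝕜))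

/-- `ν` is the uniform distribution on the Stiefel manifold `{Q ∈ 𝕜^{n × k} : Qᴴ Q = I}`: the
probability measure on it that is invariant under multiplication from the left by every
orthogonal (`𝕜 = ℝ`) or unitary (`𝕜 = ℂ`) matrix. -/
structure IsUniformStiefel {𝕜 : Type*} [RCLike 𝕜] {n k : ℕ}
    (ν : Measure (Matrix (Fin n) (Fin k) 𝕜)) : Prop where
  isProbabilityMeasure : IsProbabilityMeasure ν
  ae_mem : ∀ᵐ Q ∂ν, Q.conjTranspose * Q = 1
  invariant : ∀ W ∈ Matrix.unitaryGroup (Fin n) 𝕜, ν.map (fun Q => W * Q) = ν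

/-- The random rank-completing modification
`A + τ U D_A Vᴴ - λ (B + τ U D_B Vᴴ)` of a singular pencil, with independent random matrices `U`,
`V` that are uniformly distributed on the Stiefel manifold and diagonal matrices `D_A`, `D_B`
(deterministic or random, without any assumption on their dependence on `U`, `V`) such that `lam`
is not an eigenvalue of the pencil `D_A - λ D_B`, together with normalized right and left
eigenvectors `xi`, `yi` of the modified pencil for `lam`. -/
structure RandomModification {𝕜 : Type*} [RCLike 𝕜] {n k : ℕ} (E : SimpleEigenvalueData 𝕜 n k)
    {Ω : Type*} [MeasurableSpace Ω] (μ : Measure Ω) where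
  U : Ω → Matrix (Fin n) (Fin k) 𝕜
  V : Ω → Matrix (Fin n) (Fin k) 𝕜
  measurable_U : Measurable U
  measurable_V : Measurable V
  indep : IndepFun U V μ
  uniform_U : IsUniformStiefel (μ.map U)
  uniform_V : IsUniformStiefel (μ.map V)
  τ : 𝕜
  τ_ne_zero : τ ≠ 0
  dA : Ω → Fin k → 𝕜
  dB : Ω → Fin k → 𝕜
  generic_D : ∀ᵐ ω ∂μ, (Matrix.diagonal (dA ω) - E.lam • Matrix.diagonal (dB ω)).det ≠ 0
  xi : Ω → Fin n → 𝕜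
  yi : Ω → Fin n → 𝕜
  norm_xi : ∀ᵐ ω ∂μ, ‖WithLp.toLp 2 (xi ω)‖ = 1
  norm_yi : ∀ᵐ ω ∂μ, ‖WithLp.toLp 2 (yi ω)‖ = 1
  eigen_xi : ∀ᵐ ω ∂μ,
    ((E.A + τ • (U ω * Matrix.diagonal (dA ω) * (V ω).conjTranspose)) -
      E.lam • (E.B + τ • (U ω * Matrix.diagonal (dB ω) * (V ω).conjTranspose))).mulVec (xi ω) = 0
  eigen_yi : ∀ᵐ ω ∂μ, Matrix.vecMul (star (yi ω))
    ((E.A + τ • (U ω * Matrix.diagonal (dA ω) * (V ω).conjTranspose)) -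
      E.lam • (E.B + τ • (U ω * Matrix.diagonal (dB ω) * (V ω).conjTranspose))) = 0

namespace RandomModification

variable {𝕜 : Type*} [RCLike 𝕜] {n k : ℕ} {E : SimpleEigenvalueData 𝕜 n k}
  {Ω : Type*} [MeasurableSpace Ω] {μ : Measure Ω}

/-- The coordinate `α = xᴴ xi` of `xi = X₁ a + α x` along `x`. -/
def alpha (S : RandomModification E μ) (ω : Ω) : 𝕜 := star E.x ⬝ᵥ S.xi ω

/-- The coordinate `β = yᴴ yi` of `yi = Y₁ b + β y` along `y`. -/
def beta (S : RandomModification E μ) (ω : Ω) : 𝕜 := star E.y ⬝ᵥ S.yi ω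

/-- Almost surely `xi = X₁ a + α x`, `yi = Y₁ b + β y`, `Vᴴ xi = 0` and `Uᴴ yi = 0`. -/
def HasDecomposition (S : RandomModification E μ) : Prop :=
  ∀ᵐ ω ∂μ, (∃ a : Fin k → 𝕜, S.xi ω = E.X₁.mulVec a + S.alpha ω • E.x) ∧
    (∃ b : Fin k → 𝕜, S.yi ω = E.Y₁.mulVec b + S.beta ω • E.y) ∧
    (S.V ω).conjTranspose.mulVec (S.xi ω) = 0 ∧ (S.U ω).conjTranspose.mulVec (S.yi ω) = 0

end RandomModification

end SingularPencil

namespace SingularPencil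

/-! ### Bounds for a ratio of Gamma values -/

/-! Put `M = A - λᵢB`, `X = [X₁ x]`, `Y = [Y₁ y]`. At `λᵢ` the perturbed pencil is `M + τ U D Vᴴ`
with `D = D_A - λᵢD_B` invertible. Since `Yᴴ M = 0`, multiplying the eigenvector equation by `Yᴴ`
leaves `YᴴU D Vᴴ xᵢ = 0`. Almost surely the `(k+1) × k` matrix `YᴴU` is injective
(`IsUniformStiefel.ae_injective`), so `Vᴴxᵢ = 0` and then `M xᵢ = 0`. Hence `xᵢ = X c` for a unit
vector `c` of `𝕜^(k+1)` orthogonal to the `k` columns of `XᴴV`. This fixes `c` up to a phase, and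
`|α|` is the modulus of its last coordinate. The left eigenvector is treated alike, with `U` and
`Y`.

The eigenvectors are arbitrary functions of `ω`, so `|α|` is rewritten as `nullCoord`, the norm of
the projection of a basis vector onto the line of `c`: a measurable function of `V` alone. In the
same way `|β|` depends on `U` alone, and independence makes the mean of the product the product of
the means.

The common mean is found without identifying the law of `c`. By unitary invariance the mean of `|⟨c,
u⟩|` over `V` is `‖u‖` times a constant. Integrating against `exp (-‖u‖²)` and exchanging integrals
(`IsUniformStiefel.integral_nullCoord`) expresses the constant as a quotient of first absolute
Gaussian moments, in real dimensions `d` and `d(k+1)` with `d = dim_ℝ 𝕜`. The final bounds follow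
from log-convexity of Gamma. -/

theorem sq_Gamma_add_half_le {s : ℝ} (hs : 0 < s) :
    Real.Gamma (s + 1 / 2) ^ 2 ≤ s * Real.Gamma s ^ 2 := by
  -- Log-convexity at the midpoint of `s` and `s + 1`.
  have h := Real.Gamma_mul_add_mul_le_rpow_Gamma_mul_rpow_Gamma (s := s) (t := s + 1)
    (a := 1 / 2) (b := 1 / 2) hs (by linarith) (by norm_num) (by norm_num) (by norm_num)
  have e : 1 / 2 * s + 1 / 2 * (s + 1) = s + 1 / 2 := by ring
  have h1 := (Real.Gamma_pos_of_pos hs).le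
  have h2 := (Real.Gamma_pos_of_pos (by linarith : 0 < s + 1)).le
  rw [e, ← Real.mul_rpow h1 h2, ← Real.sqrt_eq_rpow] at h
  calc Real.Gamma (s + 1 / 2) ^ 2 ≤ √(Real.Gamma s * Real.Gamma (s + 1)) ^ 2 := by
        have := (Real.Gamma_pos_of_pos (by linarith : 0 < s + 1 / 2)).le
        gcongr
    _ = s * Real.Gamma s ^ 2 := by
        rw [Real.sq_sqrt (mul_nonneg h1 h2), Real.Gamma_add_one hs.ne']; ring

theorem one_div_le_sq_Gamma_ratio {s : ℝ} (hs : 0 < s) :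
    1 / s ≤ Real.Gamma s ^ 2 / Real.Gamma (s + 1 / 2) ^ 2 := by
  have h := Real.Gamma_pos_of_pos (by linarith : 0 < s + 1 / 2)
  rw [div_le_div_iff₀ hs (by positivity)]
  linarith [sq_Gamma_add_half_le hs]

theorem sq_Gamma_ratio_le_one_div {s : ℝ} (hs : 1 / 2 < s) :
    Real.Gamma s ^ 2 / Real.Gamma (s + 1 / 2) ^ 2 ≤ 1 / (s - 1 / 2) := by
  have hs' : 0 < s - 1 / 2 := by linarith
  have h := Real.Gamma_pos_of_pos (by linarith : 0 < s + 1 / 2)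
  -- The same inequality, shifted by one half: it bounds `Γ(s)` by `Γ(s - 1/2)`.
  have h2 := sq_Gamma_add_half_le hs'
  have e : s + 1 / 2 = (s - 1 / 2) + 1 := by ring
  rw [e, Real.Gamma_add_one hs'.ne', div_le_div_iff₀ (by rw [← Real.Gamma_add_one hs'.ne', ← e]; positivity) hs']
  rw [sub_add_cancel] at h2
  nlinarith

/-! ### Gaussian integrals of radial functions -/

section Radial

variable {E : Type*} [NormedAddCommGroup E] [NormedSpace ℝ E] [MeasurableSpace E] [BorelSpace E]
  [FiniteDimensional ℝ E]

theorem integrableOn_pow_mul_exp_neg_sq (m : ℕ) :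
    IntegrableOn (fun y : ℝ => y ^ m * Real.exp (-y ^ 2)) (Set.Ioi 0) := by
  have := integrableOn_rpow_mul_exp_neg_rpow (s := m) (p := 2)
    (by linarith [(Nat.cast_nonneg m : (0 : ℝ) ≤ m)]) (by norm_num)
  simpa only [Real.rpow_natCast, Real.rpow_two] using this

theorem integral_pow_mul_exp_neg_sq (m : ℕ) :
    ∫ y : ℝ in Set.Ioi 0, y ^ m * Real.exp (-y ^ 2) = 1 / 2 * Real.Gamma ((m + 1) / 2) := by
  have := integral_rpow_mul_exp_neg_rpow (q := m) (p := 2) (by norm_num)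
    (by linarith [(Nat.cast_nonneg m : (0 : ℝ) ≤ m)])
  simpa only [Real.rpow_natCast, Real.rpow_two] using this

theorem integrable_norm_pow_mul_exp_neg_sq [Nontrivial E] (μ : Measure E) [μ.IsAddHaarMeasure]
    (m : ℕ) : Integrable (fun x : E => ‖x‖ ^ m * Real.exp (-‖x‖ ^ 2)) μ := by
  rw [integrable_fun_norm_addHaar μ (f := fun y => y ^ m * Real.exp (-y ^ 2))]
  simpa only [smul_eq_mul, ← mul_assoc, ← pow_add] using integrableOn_pow_mul_exp_neg_sq _

/-- Polar coordinates contribute the factor `r ^ (d - 1)`, leaving a one-dimensional Gamma integral.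
The unit-ball volume cancels when two moments are compared. -/
theorem integral_norm_pow_mul_exp_neg_sq [Nontrivial E] (μ : Measure E) [μ.IsAddHaarMeasure]
    (m : ℕ) : ∫ x : E, ‖x‖ ^ m * Real.exp (-‖x‖ ^ 2) ∂μ =
      Module.finrank ℝ E * μ.real (Metric.ball 0 1) *
        (1 / 2 * Real.Gamma ((Module.finrank ℝ E + m) / 2)) := by
  have hd : 1 ≤ Module.finrank ℝ E := Module.finrank_pos
  rw [integral_fun_norm_addHaar μ (f := fun y => y ^ m * Real.exp (-y ^ 2))]
  simp only [smul_eq_mul, ← mul_assoc, ← pow_add, nsmul_eq_mul]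
  rw [integral_pow_mul_exp_neg_sq]
  push_cast [Nat.cast_sub hd]
  ring_nf

theorem integral_exp_neg_norm_sq_pos [Nontrivial E] (μ : Measure E) [μ.IsAddHaarMeasure] :
    0 < ∫ x : E, Real.exp (-‖x‖ ^ 2) ∂μ := by
  have h := integrable_norm_pow_mul_exp_neg_sq μ 0
  simp only [pow_zero, one_mul] at h
  exact integral_exp_pos h

/-- The ratio of the first and the zeroth absolute moment of a Gaussian. -/
theorem integral_norm_mul_exp_neg_sq [Nontrivial E] (μ : Measure E) [μ.IsAddHaarMeasure] :
    ∫ x : E, ‖x‖ * Real.exp (-‖x‖ ^ 2) ∂μ =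
      Real.Gamma ((Module.finrank ℝ E + 1) / 2) / Real.Gamma (Module.finrank ℝ E / 2) *
        ∫ x : E, Real.exp (-‖x‖ ^ 2) ∂μ := by
  have h0 := integral_norm_pow_mul_exp_neg_sq μ 0
  have h1 := integral_norm_pow_mul_exp_neg_sq μ 1
  simp only [pow_zero, one_mul, pow_one, Nat.cast_zero, Nat.cast_one, add_zero] at h0 h1
  have hd : (0 : ℝ) < Module.finrank ℝ E := Nat.cast_pos.2 Module.finrank_pos
  have := Real.Gamma_pos_of_pos (half_pos hd)
  rw [h0, h1]
  field_simp

/-- The image measure is again Haar, hence a multiple of `μ`; both give the unit ball the same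
positive finite mass, so the factor is 1. -/
theorem measurePreserving_linearIsometryEquiv (μ : Measure E) [μ.IsAddHaarMeasure]
    (T : E ≃ₗᵢ[ℝ] E) : MeasurePreserving T μ μ := by
  have hc : Continuous T := T.continuous
  refine ⟨hc.measurable, ?_⟩
  have : (μ.map T).IsAddHaarMeasure :=
    T.toContinuousLinearEquiv.isAddHaarMeasure_map μ
  have hb : μ.map T (Metric.ball 0 1) = μ (Metric.ball 0 1) := by
    rw [Measure.map_apply hc.measurable measurableSet_ball, T.preimage_ball, map_zero]
  have he := Measure.isAddLeftInvariant_eq_smul (μ.map T) μ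
  rw [he] at hb ⊢
  have hne : μ (Metric.ball 0 1) ≠ 0 := (Metric.measure_ball_pos μ 0 one_pos).ne'
  have hfin : μ (Metric.ball 0 1) ≠ ⊤ := measure_ball_lt_top.ne
  simp only [Measure.smul_apply] at hb
  have h1 : (Measure.addHaarScalarFactor (μ.map T) μ : ENNReal) * μ (Metric.ball 0 1) =
    1 * μ (Metric.ball 0 1) := by rw [one_mul]; exact hb
  have h2 := (ENNReal.mul_left_inj hne hfin).1 h1
  have h3 : Measure.addHaarScalarFactor (μ.map T) μ = 1 := by exact_mod_cast h2
  rw [h3, one_smul]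

end Radial

/-! ### Unitary transport of unit vectors and subspaces -/

section Transport

variable {𝕜 : Type*} [RCLike 𝕜] {V : Type*} [NormedAddCommGroup V] [InnerProductSpace 𝕜 V]
  [FiniteDimensional 𝕜 V]

theorem exists_linearIsometryEquiv_mem (S T : Submodule 𝕜 V)
    (h : Module.finrank 𝕜 S = Module.finrank 𝕜 T) :
    ∃ W : V ≃ₗᵢ[𝕜] V, ∀ v, W v ∈ T ↔ v ∈ S := by
  let e : S ≃ₗᵢ[𝕜] T := (stdOrthonormalBasis 𝕜 S).equiv (stdOrthonormalBasis 𝕜 T) (finCongr h)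
  let L : S →ₗᵢ[𝕜] V := T.subtypeₗᵢ.comp e.toLinearIsometry
  refine ⟨L.extend.toLinearIsometryEquiv rfl, fun v => ⟨fun hv => ?_, fun hv => ?_⟩⟩
  -- `W` already maps some element of `S` to `W v`; injectivity identifies it with `v`.
  · have h1 : L.extend (e.symm ⟨_, hv⟩ : S) = L.extend v := by
      rw [L.extend_apply]
      simp [L]
    have h2 := L.extend.injective h1
    rw [← h2]
    exact Subtype.coe_prop _
  · have h1 := L.extend_apply ⟨v, hv⟩
    change L.extend v ∈ T
    rw [h1]
    exact Subtype.coe_prop _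

theorem exists_linearIsometryEquiv_apply_eq {u v : V} (h : ‖u‖ = ‖v‖) :
    ∃ W : V ≃ₗᵢ[𝕜] V, W u = v := by
  by_cases hu : u = 0
  · refine ⟨LinearIsometryEquiv.refl 𝕜 V, ?_⟩
    have : ‖v‖ = 0 := by rw [← h, hu, norm_zero]
    simp [hu, norm_eq_zero.1 this]
  · let L : (Submodule.span 𝕜 {u}) →ₗᵢ[𝕜] V :=
      { toLinearMap := (LinearMap.toSpanSingleton 𝕜 V v) ∘ₗ
          (LinearEquiv.toSpanNonzeroSingleton 𝕜 V u hu).symm.toLinearMap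
        norm_map' := by
          intro x
          obtain ⟨c, rfl⟩ := (LinearEquiv.toSpanNonzeroSingleton 𝕜 V u hu).surjective x
          change ‖(LinearEquiv.toSpanNonzeroSingleton 𝕜 V u hu).symm
            (LinearEquiv.toSpanNonzeroSingleton 𝕜 V u hu c) • v‖ = ‖c • u‖
          rw [LinearEquiv.symm_apply_apply, norm_smul, norm_smul, h] }
    refine ⟨L.extend.toLinearIsometryEquiv rfl, ?_⟩
    have h1 := L.extend_apply ⟨u, Submodule.mem_span_singleton_self u⟩
    change L.extend u = v
    refine h1.trans ?_
    change (LinearEquiv.toSpanNonzeroSingleton 𝕜 V u hu).symm ⟨u, _⟩ • v = v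
    have : (LinearEquiv.toSpanNonzeroSingleton 𝕜 V u hu).symm
        ⟨u, Submodule.mem_span_singleton_self u⟩ = 1 := by
      rw [LinearEquiv.symm_apply_eq]
      ext
      simp
    rw [this, one_smul]

end Transport

/-! ### The Gaussian mean of the modulus of a coordinate -/

section Coordinate

variable (𝕜 : Type*) [RCLike 𝕜] (ι : Type*) [Fintype ι]

/-- A Haar measure on `𝕜^ι` with its Euclidean norm: the product of a Haar measure on `𝕜`. -/
noncomputable def euclideanHaar : Measure (EuclideanSpace 𝕜 ι) :=
  (Measure.pi fun _ : ι => (Measure.addHaar : Measure 𝕜)).map (WithLp.toLp 2)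

instance : (euclideanHaar 𝕜 ι).IsAddHaarMeasure :=
  (PiLp.continuousLinearEquiv 2 ℝ (fun _ : ι => 𝕜)).symm.isAddHaarMeasure_map _

variable {𝕜 ι}

theorem integral_euclideanHaar (f : EuclideanSpace 𝕜 ι → ℝ) :
    ∫ u, f u ∂(euclideanHaar 𝕜 ι) =
      ∫ u : ι → 𝕜, f (WithLp.toLp 2 u) ∂(Measure.pi fun _ : ι => Measure.addHaar) :=
  (MeasurableEquiv.toLp 2 (ι → 𝕜)).measurableEmbedding.integral_map f

theorem integral_exp_neg_norm_sq_euclideanHaar :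
    ∫ u, Real.exp (-‖u‖ ^ 2) ∂(euclideanHaar 𝕜 ι) =
      (∫ z : 𝕜, Real.exp (-‖z‖ ^ 2) ∂Measure.addHaar) ^ Fintype.card ι := by
  rw [integral_euclideanHaar]
  simp only [EuclideanSpace.norm_sq_eq, ← Finset.sum_neg_distrib, Real.exp_sum]
  rw [integral_fintype_prod_eq_prod (𝕜 := ℝ) (f := fun _ (z : 𝕜) => Real.exp (-‖z‖ ^ 2))]
  simp

/-- The Gaussian weight is a product over coordinates, so only the `j`-th factor differs from the
total mass, by the moment ratio on `𝕜`. -/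
theorem integral_norm_apply_mul_exp_neg_norm_sq (j : ι) :
    ∫ u, ‖u j‖ * Real.exp (-‖u‖ ^ 2) ∂(euclideanHaar 𝕜 ι) =
      Real.Gamma ((Module.finrank ℝ 𝕜 + 1) / 2) / Real.Gamma (Module.finrank ℝ 𝕜 / 2) *
        ∫ u, Real.exp (-‖u‖ ^ 2) ∂(euclideanHaar 𝕜 ι) := by
  classical
  rw [integral_exp_neg_norm_sq_euclideanHaar, integral_euclideanHaar]
  have h : ∀ u : ι → 𝕜, ‖u j‖ * Real.exp (-‖WithLp.toLp 2 u‖ ^ 2) =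
      ∏ i, (if i = j then ‖u i‖ else 1) * Real.exp (-‖u i‖ ^ 2) := fun u => by
    rw [Finset.prod_mul_distrib]
    simp [EuclideanSpace.norm_sq_eq, ← Finset.sum_neg_distrib, Real.exp_sum]
  simp only [h]
  rw [integral_fintype_prod_eq_prod (𝕜 := ℝ)
    (f := fun i (z : 𝕜) => (if i = j then ‖z‖ else 1) * Real.exp (-‖z‖ ^ 2)),
    ← Finset.mul_prod_erase _ _ (Finset.mem_univ j)]
  rw [Finset.prod_congr rfl (g := fun _ => ∫ z : 𝕜, Real.exp (-‖z‖ ^ 2) ∂Measure.addHaar)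
    (fun i hi => by simp [Finset.ne_of_mem_erase hi])]
  simp only [if_true, integral_norm_mul_exp_neg_sq, Finset.prod_const,
    Finset.card_erase_of_mem (Finset.mem_univ j), Finset.card_univ]
  rw [mul_assoc, ← pow_succ', Nat.sub_add_cancel (Fintype.card_pos_iff.2 ⟨j⟩)]

/-- The Gaussian mean of the modulus of the coordinate along a unit vector. -/
theorem integral_norm_inner_mul_exp_neg_norm_sq [Nonempty ι] {c : EuclideanSpace 𝕜 ι}
    (hc : ‖c‖ = 1) :
    ∫ u, ‖inner 𝕜 c u‖ * Real.exp (-‖u‖ ^ 2) ∂(euclideanHaar 𝕜 ι) =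
      Real.Gamma ((Module.finrank ℝ 𝕜 + 1) / 2) / Real.Gamma (Module.finrank ℝ 𝕜 / 2) *
        ∫ u, Real.exp (-‖u‖ ^ 2) ∂(euclideanHaar 𝕜 ι) := by
  classical
  obtain ⟨j⟩ := ‹Nonempty ι›
  obtain ⟨W, hW⟩ := exists_linearIsometryEquiv_apply_eq (𝕜 := 𝕜)
    (u := EuclideanSpace.single j (1 : 𝕜)) (v := c) (by simp [hc])
  -- Haar measure is invariant under real isometries, so `W` is regarded as one.
  let T : EuclideanSpace 𝕜 ι ≃ₗᵢ[ℝ] EuclideanSpace 𝕜 ι :=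
    { W.toLinearEquiv.restrictScalars ℝ with norm_map' := W.norm_map }
  have h := (measurePreserving_linearIsometryEquiv (euclideanHaar 𝕜 ι) T).integral_comp
    T.toHomeomorph.measurableEmbedding
    (fun u => ‖inner 𝕜 c u‖ * Real.exp (-‖u‖ ^ 2))
  rw [← h, ← integral_norm_apply_mul_exp_neg_norm_sq j]
  congr 1
  ext u
  have h1 : T u = W u := rfl
  rw [h1, ← hW, W.inner_map_map, W.norm_map]
  simp [EuclideanSpace.inner_single_left]

end Coordinate

end SingularPencil

namespace SingularPencil

/-! ### Measurability of matrix operations -/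

section Measurability

variable {𝕜 : Type*} [RCLike 𝕜] {Ω : Type*} [MeasurableSpace Ω] {l m p : Type*}

theorem measurable_matrix_entry (i : l) (j : m) : Measurable fun M : Matrix l m 𝕜 => M i j :=
  (measurable_pi_apply (X := fun _ : m => 𝕜) j).comp
    (measurable_pi_apply (X := fun _ : l => m → 𝕜) i)

theorem measurable_matrix_of_entry {f : Ω → Matrix l m 𝕜}
    (h : ∀ i j, Measurable fun ω => f ω i j) : Measurable f :=
  measurable_pi_lambda (X := fun _ : l => m → 𝕜) f fun i => measurable_pi_lambda _ fun j => h i j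

theorem measurable_entry {f : Ω → Matrix l m 𝕜} (h : Measurable f) (i : l) (j : m) :
    Measurable fun ω => f ω i j :=
  (measurable_matrix_entry i j).comp h

theorem measurable_matrix_mul [Fintype m] {f : Ω → Matrix l m 𝕜} {g : Ω → Matrix m p 𝕜}
    (hf : Measurable f) (hg : Measurable g) : Measurable fun ω => f ω * g ω := by
  refine measurable_matrix_of_entry fun i j => ?_
  simp only [Matrix.mul_apply]
  exact Finset.measurable_sum _ fun r _ => (measurable_entry hf i r).mul (measurable_entry hg r j)

theorem measurable_conjTranspose {f : Ω → Matrix l m 𝕜} (hf : Measurable f) :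
    Measurable fun ω => (f ω).conjTranspose :=
  measurable_matrix_of_entry fun i j =>
    (RCLike.continuous_conj (K := 𝕜)).measurable.comp (measurable_entry hf j i)

theorem measurable_det [Fintype m] [DecidableEq m] {f : Ω → Matrix m m 𝕜} (hf : Measurable f) :
    Measurable fun ω => (f ω).det := by
  simp only [Matrix.det_apply']
  exact Finset.measurable_sum _ fun σ _ => measurable_const.mul
    (Finset.measurable_prod _ fun i _ => measurable_entry hf _ i)

/-- Cramer's formula, valid also at singular matrices, where the inverse is zero by convention. -/
theorem measurable_matrix_inv [Fintype m] [DecidableEq m] {f : Ω → Matrix m m 𝕜}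
    (hf : Measurable f) : Measurable fun ω => (f ω)⁻¹ := by
  refine measurable_matrix_of_entry fun i j => ?_
  simp only [Matrix.inv_def, Ring.inverse_eq_inv', Matrix.smul_apply, smul_eq_mul,
    Matrix.adjugate_apply]
  refine (measurable_det hf).inv.mul (measurable_det (measurable_matrix_of_entry fun r s => ?_))
  simp only [Matrix.updateRow_apply]
  split_ifs
  · exact measurable_const
  · exact measurable_entry hf r s

end Measurability

/-! ### Unitary matrices -/

section Unitary

variable {𝕜 : Type*} [RCLike 𝕜] {ι : Type*} [Fintype ι] [DecidableEq ι]

theorem exists_mem_unitaryGroup_mulVec_eq (W : EuclideanSpace 𝕜 ι ≃ₗᵢ[𝕜] EuclideanSpace 𝕜 ι) :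
    ∃ M ∈ Matrix.unitaryGroup ι 𝕜, ∀ v : EuclideanSpace 𝕜 ι, M.mulVec v.ofLp = (W v).ofLp := by
  let b := EuclideanSpace.basisFun ι 𝕜
  refine ⟨b.toBasis.toMatrix (b.map W), b.toMatrix_orthonormalBasis_mem_unitary (b.map W),
    fun v => ?_⟩
  ext i
  conv_rhs => rw [← b.sum_repr v]
  simp [b, Matrix.mulVec, dotProduct, Module.Basis.toMatrix_apply, mul_comm]

/-- Both column spaces have dimension `card k`, so a unitary `M` carries one onto the other; `N`
holds the coordinates of the columns of `Z` in those of `M * X`. -/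
theorem exists_mem_unitaryGroup_mul_mul {k : Type*} [Fintype k] [DecidableEq k]
    {X Z : Matrix ι k 𝕜} (hX : Function.Injective X.mulVec) (hZ : Function.Injective Z.mulVec) :
    ∃ M ∈ Matrix.unitaryGroup ι 𝕜, ∃ N : Matrix k k 𝕜, Z = M * X * N := by
  let f (Y : Matrix ι k 𝕜) : (k → 𝕜) →ₗ[𝕜] EuclideanSpace 𝕜 ι :=
    (WithLp.linearEquiv 2 𝕜 (ι → 𝕜)).symm.toLinearMap ∘ₗ Y.mulVecLin
  have hf (Y : Matrix ι k 𝕜) (h : Function.Injective Y.mulVec) :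
      Module.finrank 𝕜 (LinearMap.range (f Y)) = Fintype.card k := by
    rw [LinearMap.finrank_range_of_inj, Module.finrank_fintype_fun_eq_card]
    exact (WithLp.linearEquiv 2 𝕜 (ι → 𝕜)).symm.injective.comp h
  obtain ⟨W, hW⟩ := exists_linearIsometryEquiv_mem (LinearMap.range (f X))
    (LinearMap.range (f Z)) ((hf X hX).trans (hf Z hZ).symm)
  obtain ⟨M, hM, hMW⟩ := exists_mem_unitaryGroup_mulVec_eq W
  have h (r : k) : ∃ c, M.mulVec (X.mulVec c) = Z.mulVec (Pi.single r 1) := by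
    have h1 : W.symm (f Z (Pi.single r 1)) ∈ LinearMap.range (f X) := by
      rw [← hW, W.apply_symm_apply]
      exact LinearMap.mem_range_self _ _
    obtain ⟨c, hc⟩ := h1
    refine ⟨c, ?_⟩
    have h2 := hMW (f X c)
    rw [hc, W.apply_symm_apply, ← hc] at h2
    exact h2
  choose c hc using h
  refine ⟨M, hM, Matrix.of fun i r => c r i, ?_⟩
  ext i r
  have h3 := congrFun (hc r) i
  rw [Matrix.mulVec_single_one, Matrix.mulVec_mulVec] at h3
  exact h3.symm

end Unitary

/-! ### Generic position of a uniform point of the Stiefel manifold -/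

section Generic

variable {𝕜 : Type*} [RCLike 𝕜] {n k : ℕ}

theorem mulVec_injective_of_conjTranspose_mul_self {l m : Type*} [Fintype l] [Fintype m]
    [DecidableEq m] {X : Matrix l m 𝕜} (hX : X.conjTranspose * X = 1) :
    Function.Injective X.mulVec := by
  intro v w h
  have := congrArg X.conjTranspose.mulVec h
  simpa [Matrix.mulVec_mulVec, hX] using this

/-- The determinant is the characteristic polynomial of `-A` at `t`, which has finitely many roots.
-/
theorem ae_det_add_smul_one_ne_zero {m : Type*} [Fintype m] [DecidableEq m] (A : Matrix m m 𝕜) :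
    ∀ᵐ t : ℝ, (A + (t : 𝕜) • (1 : Matrix m m 𝕜)).det ≠ 0 := by
  have hfin : {t : ℝ | (-A).charpoly.IsRoot (t : 𝕜)}.Finite :=
    (Polynomial.finite_setOfPred_isRoot (Matrix.charpoly_monic (-A)).ne_zero).preimage
      RCLike.ofReal_injective.injOn
  rw [ae_iff]
  refine measure_mono_null (fun t ht => ?_) (hfin.measure_zero volume)
  simp only [ne_eq, not_not, Set.mem_ofPred_eq] at ht ⊢
  rw [Polynomial.IsRoot, Matrix.eval_charpoly, ← ht]
  congr 1
  rw [Matrix.smul_one_eq_diagonal]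
  simp [add_comm, Matrix.scalar_apply]

/-- On each line `Z + tQ` the matrix is `ZᴴQ + t·1`, singular for only finitely many `t`; Fubini
along the direction `Q` gives almost every `Z`. -/
theorem ae_det_conjTranspose_mul_ne_zero {Q : Matrix (Fin n) (Fin k) 𝕜}
    (hQ : Q.conjTranspose * Q = 1) :
    ∀ᵐ Z : Fin n → Fin k → 𝕜 ∂Measure.addHaar, ((Matrix.of Z).conjTranspose * Q).det ≠ 0 := by
  have hm : MeasurableSet {Z : Fin n → Fin k → 𝕜 | ((Matrix.of Z).conjTranspose * Q).det ≠ 0} :=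
    (measurable_det (measurable_matrix_mul (measurable_conjTranspose
      (measurable_id (α := Matrix (Fin n) (Fin k) 𝕜))) measurable_const))
      (measurableSet_singleton 0).compl
  let L : ℝ →ₗ[ℝ] (Fin n → Fin k → 𝕜) := LinearMap.toSpanSingleton ℝ _ (Q : Fin n → Fin k → 𝕜)
  refine ae_mem_of_ae_add_linearMap_mem L volume Measure.addHaar hm fun Z => ?_
  filter_upwards [ae_det_add_smul_one_ne_zero ((Matrix.of Z).conjTranspose * Q)] with t ht
  convert ht using 2
  have : Matrix.of (Z + L t) = Matrix.of Z + (t : 𝕜) • Q := by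
    ext i j
    change Z i j + t • Q i j = Z i j + (t : 𝕜) * Q i j
    rw [RCLike.real_smul_eq_coe_mul]
  rw [this, Matrix.conjTranspose_add, Matrix.conjTranspose_smul, Matrix.add_mul,
    Matrix.smul_mul, hQ]
  simp

/-- The compression of a uniform point of the Stiefel manifold to a fixed `k`-dimensional subspace
is almost surely invertible. -/
theorem IsUniformStiefel.ae_det_ne_zero {ν : Measure (Matrix (Fin n) (Fin k) 𝕜)}
    (hν : IsUniformStiefel ν) {X : Matrix (Fin n) (Fin k) 𝕜} (hX : X.conjTranspose * X = 1) :
    ∀ᵐ Q ∂ν, (X.conjTranspose * Q).det ≠ 0 := by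
  have := hν.isProbabilityMeasure
  have hm : MeasurableSet {q : Matrix (Fin n) (Fin k) 𝕜 × (Fin n → Fin k → 𝕜) |
      ((Matrix.of q.2).conjTranspose * q.1).det ≠ 0} :=
    (measurable_det (measurable_matrix_mul (measurable_conjTranspose
      (f := fun q : Matrix (Fin n) (Fin k) 𝕜 × (Fin n → Fin k → 𝕜) => Matrix.of q.2)
      measurable_snd) measurable_fst)) (measurableSet_singleton 0).compl
  have h1 : ∀ᵐ Q ∂ν, ∀ᵐ Z : Fin n → Fin k → 𝕜 ∂Measure.addHaar,
      ((Matrix.of Z).conjTranspose * Q).det ≠ 0 :=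
    hν.ae_mem.mono fun Q hQ => ae_det_conjTranspose_mul_ne_zero hQ
  -- Exchanging the quantifiers yields one fixed `Z` that works for almost every `Q`; invariance of
  -- `ν` will move it to `X`.
  obtain ⟨Z, hZ⟩ := ((Measure.ae_ae_comm hm).1 h1).exists
  obtain ⟨Q₀, hQ₀⟩ := hZ.exists
  -- `Z` has full column rank because `Q₀ᴴ Z` is invertible.
  have hZinj : Function.Injective (Matrix.of Z).mulVec := by
    have h2 : Function.Injective ((Matrix.of Z).conjTranspose * Q₀).conjTranspose.mulVec :=
      Matrix.mulVec_injective_of_isUnit ((Matrix.isUnit_iff_isUnit_det _).2 (by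
        rw [Matrix.det_conjTranspose]
        exact (isUnit_iff_ne_zero.2 hQ₀).star))
    rw [Matrix.conjTranspose_mul, Matrix.conjTranspose_conjTranspose] at h2
    intro v w hvw
    apply h2
    simp only [← Matrix.mulVec_mulVec, hvw]
  obtain ⟨M, hM, N, hN⟩ := exists_mem_unitaryGroup_mul_mul
    (mulVec_injective_of_conjTranspose_mul_self hX) hZinj
  rw [← hν.invariant M hM] at hZ
  have hmM : Measurable fun Q : Matrix (Fin n) (Fin k) 𝕜 => M * Q :=
    measurable_matrix_mul measurable_const measurable_id
  filter_upwards [ae_of_ae_map hmM.aemeasurable hZ] with Q hQ h0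
  apply hQ
  have h3 : (Matrix.of Z).conjTranspose * (M * Q) =
      N.conjTranspose * (X.conjTranspose * Q) := by
    have hM' : M.conjTranspose * M = 1 := Matrix.mem_unitaryGroup_iff'.1 hM
    rw [hN]
    simp only [Matrix.conjTranspose_mul, Matrix.mul_assoc]
    rw [← Matrix.mul_assoc M.conjTranspose, hM', Matrix.one_mul]
  rw [h3, Matrix.det_mul, h0, mul_zero]

end Generic

end SingularPencil

namespace SingularPencil

/-! ### The projection onto the orthogonal complement of a column space -/

section Residual

variable {𝕜 : Type*} [RCLike 𝕜] {ι κ : Type*} [Fintype ι] [DecidableEq ι] [Fintype κ]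
  [DecidableEq κ]

/-- The orthogonal projection onto the orthogonal complement of the column space of `W`, for a
matrix `W` of full column rank. -/
noncomputable def residual (W : Matrix ι κ 𝕜) : Matrix ι ι 𝕜 :=
  1 - W * (W.conjTranspose * W)⁻¹ * W.conjTranspose

theorem residual_unitary_mul {Z : Matrix ι ι 𝕜} (hZ : Z ∈ Matrix.unitaryGroup ι 𝕜)
    (W : Matrix ι κ 𝕜) : residual (Z * W) = Z * residual W * Z.conjTranspose := by
  have h1 : Z.conjTranspose * Z = 1 := Matrix.mem_unitaryGroup_iff'.1 hZ
  have h2 : Z * Z.conjTranspose = 1 := Matrix.mem_unitaryGroup_iff.1 hZ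
  have h3 : (Z * W).conjTranspose * (Z * W) = W.conjTranspose * W := by
    rw [Matrix.conjTranspose_mul, Matrix.mul_assoc, ← Matrix.mul_assoc _ Z, h1, Matrix.one_mul]
  rw [residual, h3]
  simp only [residual, Matrix.mul_sub, Matrix.sub_mul, Matrix.mul_one, h2,
    Matrix.conjTranspose_mul, Matrix.mul_assoc]

/-- The square matrix `[W c]` has the left inverse with row blocks `(WᴴW)⁻¹Wᴴ` and `cᴴ`. It is also
a right inverse, which says `W(WᴴW)⁻¹Wᴴ + c cᴴ = 1`. -/
theorem residual_eq {W : Matrix (κ ⊕ Unit) κ 𝕜} (hW : (W.conjTranspose * W).det ≠ 0)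
    {c : κ ⊕ Unit → 𝕜} (hc : star c ⬝ᵥ c = 1) (hWc : W.conjTranspose.mulVec c = 0) :
    residual W = Matrix.vecMulVec c (star c) := by
  set C := Matrix.replicateCol Unit c with hC
  have hCC : C.conjTranspose * C = 1 := by
    ext i j
    simpa [C, Matrix.mul_apply, dotProduct] using hc
  have hWC : W.conjTranspose * C = 0 := by
    ext i j
    simpa [C, Matrix.mul_apply, Matrix.mulVec, dotProduct] using congrFun hWc i
  have hCW : C.conjTranspose * W = 0 := by
    rw [← Matrix.conjTranspose_conjTranspose W, ← Matrix.conjTranspose_mul, hWC,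
      Matrix.conjTranspose_zero]
  have hinv : (W.conjTranspose * W)⁻¹ * (W.conjTranspose * W) = 1 :=
    Matrix.nonsing_inv_mul _ (isUnit_iff_ne_zero.2 hW)
  have h1 : (Matrix.fromRows ((W.conjTranspose * W)⁻¹ * W.conjTranspose) C.conjTranspose) *
      (Matrix.fromCols W C) = 1 := by
    rw [Matrix.fromRows_mul_fromCols, Matrix.mul_assoc, Matrix.mul_assoc, hinv, hWC, hCW, hCC,
      Matrix.mul_zero, Matrix.fromBlocks_one]
  rw [mul_eq_one_comm, Matrix.fromCols_mul_fromRows] at h1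
  rw [residual, ← h1, Matrix.mul_assoc, add_sub_cancel_left]
  ext i j
  simp [C, Matrix.mul_apply, Matrix.vecMulVec_apply]

omit [DecidableEq ι] in
theorem norm_mulVec_of_conjTranspose_mul_self {Z : Matrix ι κ 𝕜} (hZ : Z.conjTranspose * Z = 1)
    (v : κ → 𝕜) : ‖WithLp.toLp 2 (Z.mulVec v)‖ = ‖WithLp.toLp 2 v‖ := by
  have h : inner 𝕜 (WithLp.toLp 2 (Z.mulVec v)) (WithLp.toLp 2 (Z.mulVec v)) =
      inner 𝕜 (WithLp.toLp 2 v) (WithLp.toLp 2 v) := by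
    rw [EuclideanSpace.inner_toLp_toLp, EuclideanSpace.inner_toLp_toLp, dotProduct_comm,
      Matrix.star_mulVec, ← Matrix.dotProduct_mulVec, Matrix.mulVec_mulVec, hZ, Matrix.one_mulVec,
      dotProduct_comm]
  rw [inner_self_eq_norm_sq_to_K, inner_self_eq_norm_sq_to_K] at h
  have h2 : ‖WithLp.toLp 2 (Z.mulVec v)‖ ^ 2 = ‖WithLp.toLp 2 v‖ ^ 2 := by exact_mod_cast h
  exact (sq_eq_sq₀ (norm_nonneg _) (norm_nonneg _)).1 h2

end Residual

/-! ### The mean modulus of a coordinate of a random null vector -/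

section Mean

variable {𝕜 : Type*} [RCLike 𝕜] {n k : ℕ}

/-- The modulus of the coordinate along `u` of a unit vector orthogonal to the columns of
`Xᴴ Q`. -/
noncomputable def nullCoord (X : Matrix (Fin n) (Fin k ⊕ Unit) 𝕜) (Q : Matrix (Fin n) (Fin k) 𝕜)
    (u : EuclideanSpace 𝕜 (Fin k ⊕ Unit)) : ℝ :=
  ‖WithLp.toLp 2 ((residual (X.conjTranspose * Q)).mulVec u.ofLp)‖

theorem measurable_nullCoord (X : Matrix (Fin n) (Fin k ⊕ Unit) 𝕜) :
    Measurable fun q : Matrix (Fin n) (Fin k) 𝕜 × EuclideanSpace 𝕜 (Fin k ⊕ Unit) =>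
      nullCoord X q.1 q.2 := by
  have hW : Measurable fun q : Matrix (Fin n) (Fin k) 𝕜 × EuclideanSpace 𝕜 (Fin k ⊕ Unit) =>
      X.conjTranspose * q.1 := measurable_matrix_mul measurable_const measurable_fst
  have hW' := measurable_conjTranspose hW
  have hP := measurable_matrix_mul (measurable_matrix_mul hW
    (measurable_matrix_inv (measurable_matrix_mul hW' hW))) hW'
  have hu (j : Fin k ⊕ Unit) : Measurable
      fun q : Matrix (Fin n) (Fin k) 𝕜 × EuclideanSpace 𝕜 (Fin k ⊕ Unit) => q.2 j :=
    (EuclideanSpace.proj (𝕜 := 𝕜) j).continuous.measurable.comp measurable_snd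
  simp only [nullCoord, EuclideanSpace.norm_eq, Matrix.mulVec, dotProduct, residual,
    Matrix.sub_apply]
  refine Real.continuous_sqrt.measurable.comp (Finset.measurable_sum _ fun i _ => ?_)
  refine (Measurable.norm (Finset.measurable_sum _ fun j _ => ?_)).pow_const 2
  exact (measurable_const.sub (measurable_entry hP i j)).mul (hu j)

theorem measurable_nullCoord_left (X : Matrix (Fin n) (Fin k ⊕ Unit) 𝕜)
    (u : EuclideanSpace 𝕜 (Fin k ⊕ Unit)) : Measurable fun Q => nullCoord X Q u :=
  Measurable.comp (g := fun q : Matrix (Fin n) (Fin k) 𝕜 × EuclideanSpace 𝕜 (Fin k ⊕ Unit) =>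
    nullCoord X q.1 q.2) (f := fun Q => (Q, u)) (measurable_nullCoord X)
    (measurable_id.prodMk measurable_const)

theorem nullCoord_smul (X : Matrix (Fin n) (Fin k ⊕ Unit) 𝕜) (Q : Matrix (Fin n) (Fin k) 𝕜)
    (a : 𝕜) (u : EuclideanSpace 𝕜 (Fin k ⊕ Unit)) :
    nullCoord X Q (a • u) = ‖a‖ * nullCoord X Q u := by
  simp only [nullCoord, WithLp.ofLp_smul, Matrix.mulVec_smul, WithLp.toLp_smul, norm_smul]

theorem nullCoord_eq {X : Matrix (Fin n) (Fin k ⊕ Unit) 𝕜} {Q : Matrix (Fin n) (Fin k) 𝕜}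
    (hW : ((X.conjTranspose * Q).conjTranspose * (X.conjTranspose * Q)).det ≠ 0)
    {c : EuclideanSpace 𝕜 (Fin k ⊕ Unit)} (hc : ‖c‖ = 1)
    (hWc : (X.conjTranspose * Q).conjTranspose.mulVec c.ofLp = 0)
    (u : EuclideanSpace 𝕜 (Fin k ⊕ Unit)) : nullCoord X Q u = ‖inner 𝕜 c u‖ := by
  have h1 : star c.ofLp ⬝ᵥ c.ofLp = 1 := by
    rw [dotProduct_comm, ← EuclideanSpace.inner_eq_star_dotProduct, inner_self_eq_norm_sq_to_K, hc]
    simp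
  rw [nullCoord, residual_eq hW h1 hWc, Matrix.vecMulVec_mulVec,
    EuclideanSpace.inner_eq_star_dotProduct, dotProduct_comm u.ofLp]
  have : WithLp.toLp 2 (MulOpposite.op (star c.ofLp ⬝ᵥ u.ofLp) • c.ofLp) =
      (star c.ofLp ⬝ᵥ u.ofLp) • c := by
    ext i
    simp [mul_comm]
  rw [this, norm_smul, hc, mul_one]

open scoped ComplexOrder in
theorem det_conjTranspose_mul_self_ne_zero {l m : Type*} [Fintype l] [Fintype m] [DecidableEq m]
    {W : Matrix l m 𝕜} (hW : Function.Injective W.mulVec) : (W.conjTranspose * W).det ≠ 0 := by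
  intro h
  obtain ⟨v, hv, hv0⟩ := Matrix.exists_mulVec_eq_zero_iff.2 h
  rw [Matrix.conjTranspose_mul_self_mulVec_eq_zero] at hv0
  exact hv (hW (by rw [hv0, Matrix.mulVec_zero]))

variable {ν : Measure (Matrix (Fin n) (Fin k) 𝕜)} {X : Matrix (Fin n) (Fin k ⊕ Unit) 𝕜}

theorem IsUniformStiefel.ae_injective (hν : IsUniformStiefel ν) (hX : X.conjTranspose * X = 1) :
    ∀ᵐ Q ∂ν, Function.Injective (X.conjTranspose * Q).mulVec := by
  -- The first `k` rows of `XᴴQ` already form an almost surely invertible block.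
  have hX₁ : (X.submatrix id Sum.inl).conjTranspose * X.submatrix id Sum.inl = 1 := by
    rw [Matrix.conjTranspose_submatrix, ← Matrix.submatrix_mul _ _ _ _ _ Function.bijective_id, hX,
      Matrix.submatrix_one _ Sum.inl_injective]
  filter_upwards [hν.ae_det_ne_zero hX₁] with Q hQ v w hvw
  refine Matrix.mulVec_injective_of_isUnit ((Matrix.isUnit_iff_isUnit_det _).2
    (isUnit_iff_ne_zero.2 hQ)) ?_
  ext i
  exact congrFun hvw (Sum.inl i)

theorem IsUniformStiefel.ae_nullCoord_eq (hν : IsUniformStiefel ν)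
    (hX : X.conjTranspose * X = 1) :
    ∀ᵐ Q ∂ν, ∃ c : EuclideanSpace 𝕜 (Fin k ⊕ Unit), ‖c‖ = 1 ∧
      ∀ u, nullCoord X Q u = ‖inner 𝕜 c u‖ := by
  filter_upwards [hν.ae_injective hX] with Q hQ
  -- `k` linear conditions on `k + 1` unknowns.
  have hker : LinearMap.ker (X.conjTranspose * Q).conjTranspose.mulVecLin ≠ ⊥ :=
    LinearMap.ker_ne_bot_of_finrank_lt (by simp)
  obtain ⟨v, hv, hv0⟩ := (Submodule.ne_bot_iff _).1 hker
  have hv1 : WithLp.toLp 2 v ≠ 0 := fun h => hv0 (by simpa using congrArg WithLp.ofLp h)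
  have hv2 : (X.conjTranspose * Q).conjTranspose.mulVec v = 0 := hv
  obtain ⟨a, ha⟩ : ∃ a : 𝕜, ‖a • WithLp.toLp 2 v‖ = 1 := ⟨_, norm_smul_inv_norm hv1⟩
  refine ⟨a • WithLp.toLp 2 v, ha,
    nullCoord_eq (det_conjTranspose_mul_self_ne_zero hQ) ha ?_⟩
  rw [WithLp.ofLp_smul, Matrix.mulVec_smul, hv2, smul_zero]

theorem nullCoord_unitary_mul (hX : X.conjTranspose * X = 1)
    {Z : Matrix (Fin k ⊕ Unit) (Fin k ⊕ Unit) 𝕜} (hZ : Z ∈ Matrix.unitaryGroup (Fin k ⊕ Unit) 𝕜) :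
    ∃ M ∈ Matrix.unitaryGroup (Fin n) 𝕜, ∀ Q u,
      nullCoord X (M * Q) (WithLp.toLp 2 (Z.mulVec u)) = nullCoord X Q (WithLp.toLp 2 u) := by
  have h1 : Z.conjTranspose * Z = 1 := Matrix.mem_unitaryGroup_iff'.1 hZ
  have h2 : Z * Z.conjTranspose = 1 := Matrix.mem_unitaryGroup_iff.1 hZ
  have hX' {m : Type} (A : Matrix (Fin k ⊕ Unit) m 𝕜) : X.conjTranspose * (X * A) = A := by
    rw [← Matrix.mul_assoc, hX, Matrix.one_mul]
  have h2' {m : Type} (A : Matrix (Fin k ⊕ Unit) m 𝕜) : Z * (Z.conjTranspose * A) = A := by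
    rw [← Matrix.mul_assoc, h2, Matrix.one_mul]
  -- This matrix acts as `Z` on the column space of `X` and as the identity on its orthogonal
  -- complement, so `XᴴMQ = Z XᴴQ`.
  refine ⟨X * Z * X.conjTranspose + (1 - X * X.conjTranspose), ?_, fun Q u => ?_⟩
  · rw [Matrix.mem_unitaryGroup_iff, Matrix.star_eq_conjTranspose]
    simp only [Matrix.conjTranspose_add, Matrix.conjTranspose_sub, Matrix.conjTranspose_mul,
      Matrix.conjTranspose_conjTranspose, Matrix.conjTranspose_one, Matrix.add_mul, Matrix.mul_add,
      Matrix.sub_mul, Matrix.mul_sub, Matrix.mul_one, Matrix.one_mul, Matrix.mul_assoc, hX', h2']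
    abel
  · have h3 : X.conjTranspose * ((X * Z * X.conjTranspose + (1 - X * X.conjTranspose)) * Q) =
        Z * (X.conjTranspose * Q) := by
      simp only [Matrix.add_mul, Matrix.mul_add, Matrix.sub_mul, Matrix.mul_sub, Matrix.one_mul,
        Matrix.mul_assoc, hX']
      abel
    rw [nullCoord, h3, residual_unitary_mul hZ, Matrix.mulVec_mulVec, Matrix.mul_assoc, h1,
      Matrix.mul_one, ← Matrix.mulVec_mulVec, norm_mulVec_of_conjTranspose_mul_self h1]
    rfl

/-- A unitary sends `‖u‖ • e` to `u`; it lifts to a unitary of `𝕜^n`, which the law `ν` does not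
see. -/
theorem IsUniformStiefel.integral_nullCoord_eq_norm_mul (hν : IsUniformStiefel ν)
    (hX : X.conjTranspose * X = 1) {e : EuclideanSpace 𝕜 (Fin k ⊕ Unit)} (he : ‖e‖ = 1)
    (u : EuclideanSpace 𝕜 (Fin k ⊕ Unit)) :
    ∫ Q, nullCoord X Q u ∂ν = ‖u‖ * ∫ Q, nullCoord X Q e ∂ν := by
  obtain ⟨W, hW⟩ := exists_linearIsometryEquiv_apply_eq (𝕜 := 𝕜)
    (u := ((‖u‖ : ℝ) : 𝕜) • e) (v := u) (by simp [norm_smul, he])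
  obtain ⟨Z, hZ, hZW⟩ := exists_mem_unitaryGroup_mulVec_eq W
  obtain ⟨M, hM, hMQ⟩ := nullCoord_unitary_mul hX hZ
  have hmM : Measurable fun Q : Matrix (Fin n) (Fin k) 𝕜 => M * Q :=
    measurable_matrix_mul measurable_const measurable_id
  have hu : u = WithLp.toLp 2 (Z.mulVec (((‖u‖ : ℝ) : 𝕜) • e).ofLp) := by rw [hZW, hW]
  conv_lhs => rw [hu, ← hν.invariant M hM]
  rw [integral_map hmM.aemeasurable (measurable_nullCoord_left X _).aestronglyMeasurable,
    ← integral_const_mul]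
  congr 1
  ext Q
  rw [hMQ, WithLp.toLp_ofLp, nullCoord_smul]
  simp

/-- One double integral evaluated twice: with `Q` fixed, `nullCoord` is a coordinate along a unit
vector and gives the moment on `𝕜`; with `u` fixed, it is `‖u‖` times the unknown and gives the
moment on `𝕜^(k+1)`. -/
theorem IsUniformStiefel.integral_nullCoord (hν : IsUniformStiefel ν)
    (hX : X.conjTranspose * X = 1) {e : EuclideanSpace 𝕜 (Fin k ⊕ Unit)} (he : ‖e‖ = 1) :
    ∫ Q, nullCoord X Q e ∂ν =
      Real.Gamma ((Module.finrank ℝ 𝕜 + 1) / 2) / Real.Gamma (Module.finrank ℝ 𝕜 / 2) *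
        (Real.Gamma (Module.finrank ℝ 𝕜 * (k + 1) / 2) /
          Real.Gamma ((Module.finrank ℝ 𝕜 * (k + 1) + 1) / 2)) := by
  have := hν.isProbabilityMeasure
  let γ := euclideanHaar 𝕜 (Fin k ⊕ Unit)
  have hdim : (Module.finrank ℝ (EuclideanSpace 𝕜 (Fin k ⊕ Unit)) : ℝ) =
      Module.finrank ℝ 𝕜 * (k + 1) := by
    rw [← Module.finrank_mul_finrank ℝ 𝕜 (EuclideanSpace 𝕜 (Fin k ⊕ Unit)),
      finrank_euclideanSpace]
    simp
  have hint : Integrable (Function.uncurry fun (Q : Matrix (Fin n) (Fin k) 𝕜)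
      (u : EuclideanSpace 𝕜 (Fin k ⊕ Unit)) => nullCoord X Q u * Real.exp (-‖u‖ ^ 2))
      (ν.prod γ) := by
    -- By Cauchy–Schwarz `|⟨c, u⟩| ≤ ‖u‖`, so this function dominates.
    have hg : Integrable (fun q : Matrix (Fin n) (Fin k) 𝕜 × EuclideanSpace 𝕜 (Fin k ⊕ Unit) =>
        (1 : ℝ) * (‖q.2‖ ^ 1 * Real.exp (-‖q.2‖ ^ 2))) (ν.prod γ) :=
      (integrable_const (1 : ℝ)).mul_prod (integrable_norm_pow_mul_exp_neg_sq γ 1)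
    refine hg.mono' ?_ ?_
    · exact ((measurable_nullCoord X).mul (by fun_prop)).aestronglyMeasurable
    · filter_upwards [Measure.quasiMeasurePreserving_fst.ae (hν.ae_nullCoord_eq hX)] with q hq
      obtain ⟨c, hc, hq⟩ := hq
      have h := norm_inner_le_norm (𝕜 := 𝕜) c q.2
      rw [hc, one_mul] at h
      simp only [Function.uncurry, hq, norm_mul, Real.norm_eq_abs, Real.abs_exp, one_mul,
        pow_one, abs_norm]
      gcongr
  have hswap := integral_integral_swap hint
  have hleft : ∀ᵐ Q ∂ν, ∫ u, nullCoord X Q u * Real.exp (-‖u‖ ^ 2) ∂γ =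
      Real.Gamma ((Module.finrank ℝ 𝕜 + 1) / 2) / Real.Gamma (Module.finrank ℝ 𝕜 / 2) *
        ∫ u, Real.exp (-‖u‖ ^ 2) ∂γ := by
    filter_upwards [hν.ae_nullCoord_eq hX] with Q hQ
    obtain ⟨c, hc, hQ⟩ := hQ
    simp only [hQ]
    exact integral_norm_inner_mul_exp_neg_norm_sq hc
  rw [integral_congr_ae hleft, integral_const] at hswap
  simp only [probReal_univ, one_smul, integral_mul_const] at hswap
  have h3 : ∫ u, (∫ Q, nullCoord X Q u ∂ν) * Real.exp (-‖u‖ ^ 2) ∂γ =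
      (∫ Q, nullCoord X Q e ∂ν) * ∫ u, ‖u‖ * Real.exp (-‖u‖ ^ 2) ∂γ := by
    rw [← integral_const_mul]
    congr 1
    ext u
    rw [hν.integral_nullCoord_eq_norm_mul hX he u]
    ring
  rw [h3, integral_norm_mul_exp_neg_sq, hdim] at hswap
  have hpos := integral_exp_neg_norm_sq_pos γ
  have hr : (0 : ℝ) < Module.finrank ℝ 𝕜 := Nat.cast_pos.2 Module.finrank_pos
  have hd : (0 : ℝ) < Module.finrank ℝ 𝕜 * (k + 1) := by positivity
  have g1 := Real.Gamma_pos_of_pos (half_pos hr)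
  have g2 := Real.Gamma_pos_of_pos (half_pos hd)
  have g3 := Real.Gamma_pos_of_pos (half_pos (by linarith : 0 < (Module.finrank ℝ 𝕜 : ℝ) * (k + 1) + 1))
  rw [← mul_assoc (∫ Q, nullCoord X Q e ∂ν)] at hswap
  have hswap' := mul_right_cancel₀ hpos.ne' hswap
  rw [hswap']
  field_simp

end Mean

end SingularPencil

namespace SingularPencil

/-! ### Descent of kernels from `ℂ` to `𝕜`, and null vectors of the perturbed matrix -/

section Kernels

variable {𝕜 : Type*} [RCLike 𝕜] {l m p : Type*}

/-- `RCLike.map` is only real-linear in general (from `ℂ` to `ℝ` it drops imaginary parts); the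
target `ℂ` makes it multiplicative. -/
theorem map_complex_mul (a b : 𝕜) :
    RCLike.map 𝕜 ℂ (a * b) = RCLike.map 𝕜 ℂ a * RCLike.map 𝕜 ℂ b := by
  apply Complex.ext <;> simp [RCLike.map_apply, RCLike.mul_re, RCLike.mul_im]

theorem map_complex_injective : Function.Injective (RCLike.map 𝕜 ℂ) := by
  intro a b h
  have h1 := congrArg Complex.re h
  have h2 := congrArg Complex.im h
  simp only [RCLike.map_apply] at h1 h2
  exact RCLike.ext (by simpa using h1) (by simpa using h2)

theorem toC_injective : Function.Injective (toC : Matrix l m 𝕜 → Matrix l m ℂ) :=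
  Matrix.map_injective map_complex_injective

theorem toC_mul [Fintype m] (M : Matrix l m 𝕜) (N : Matrix m p 𝕜) :
    toC (M * N) = toC M * toC N := by
  ext i j
  simp only [toC, Matrix.map_apply, Matrix.mul_apply, map_sum, map_complex_mul]

theorem toC_zero : toC (0 : Matrix l m 𝕜) = 0 :=
  Matrix.map_zero _ (map_zero (RCLike.map 𝕜 ℂ))

theorem toC_one [DecidableEq m] : toC (1 : Matrix m m 𝕜) = 1 :=
  Matrix.map_one _ (map_zero (RCLike.map 𝕜 ℂ)) (by simp [RCLike.map_apply])

theorem toC_conjTranspose (M : Matrix l m 𝕜) : toC M.conjTranspose = (toC M).conjTranspose :=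
  Matrix.conjTranspose_map _ fun z => by simp [RCLike.map_apply]

theorem mul_eq_zero_of_range_toC_le [Fintype m] [Fintype p] [DecidableEq p] {M : Matrix l m 𝕜}
    {X : Matrix m p 𝕜} (h : LinearMap.range (toC X).mulVecLin ≤ LinearMap.ker (toC M).mulVecLin) :
    M * X = 0 := by
  apply toC_injective
  rw [toC_mul, toC_zero]
  refine Matrix.ext_of_mulVec_single fun j => ?_
  rw [← Matrix.mulVec_mulVec, Matrix.zero_mulVec]
  exact h (LinearMap.mem_range_self _ _)

/-- The coordinates of `z` exist a priori over `ℂ`, but orthonormality forces them to be `Xᴴz`,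
which has entries in `𝕜`. -/
theorem eq_mulVec_of_ker_toC_le_range [Fintype m] [Fintype p] [DecidableEq p]
    {M : Matrix l m 𝕜} {X : Matrix m p 𝕜} (hX : X.conjTranspose * X = 1)
    (h : LinearMap.ker (toC M).mulVecLin ≤ LinearMap.range (toC X).mulVecLin) {z : m → 𝕜}
    (hz : M.mulVec z = 0) : z = X.mulVec (X.conjTranspose.mulVec z) := by
  set Z := Matrix.replicateCol Unit z with hZ
  have hMZ : M * Z = 0 := by
    rw [hZ, Matrix.replicateCol_mulVec M z |>.symm, hz]; rfl
  have hX' : (toC X).conjTranspose * toC X = 1 := by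
    rw [← toC_conjTranspose, ← toC_mul, hX, toC_one]
  obtain ⟨c, hc⟩ := h (show (toC Z).mulVec (Pi.single () 1) ∈ LinearMap.ker (toC M).mulVecLin by
    rw [LinearMap.mem_ker, Matrix.mulVecLin_apply, Matrix.mulVec_mulVec, ← toC_mul, hMZ, toC_zero,
      Matrix.zero_mulVec])
  rw [Matrix.mulVecLin_apply] at hc
  have hZX : Z = X * (X.conjTranspose * Z) := by
    apply toC_injective
    refine Matrix.ext_of_mulVec_single fun j => ?_
    rw [toC_mul, toC_mul, toC_conjTranspose, ← Matrix.mulVec_mulVec, ← Matrix.mulVec_mulVec, ← hc,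
      Matrix.mulVec_mulVec c, hX', Matrix.one_mulVec]
  ext i
  exact congrFun (congrFun hZX i) ()

/-- Multiplication by `Yᴴ` removes `M`; then `τ`, `YᴴU` and `D` are cancelled in turn. -/
theorem mulVec_eq_zero_of_add_mulVec_eq_zero [Fintype l] [Fintype m] [Fintype p]
    [DecidableEq p] {M : Matrix l l 𝕜} {Y : Matrix l m 𝕜} {U V : Matrix l p 𝕜} {D : Matrix p p 𝕜}
    {τ : 𝕜} (hY : Y.conjTranspose * M = 0) (hU : Function.Injective (Y.conjTranspose * U).mulVec)
    (hD : D.det ≠ 0) (hτ : τ ≠ 0) {z : l → 𝕜}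
    (hz : (M + τ • (U * D * V.conjTranspose)).mulVec z = 0) :
    V.conjTranspose.mulVec z = 0 ∧ M.mulVec z = 0 := by
  have hV : V.conjTranspose.mulVec z = 0 := by
    have h1 := congrArg Y.conjTranspose.mulVec hz
    rw [Matrix.mulVec_mulVec, Matrix.mul_add, hY, zero_add, Matrix.mulVec_zero, Matrix.mul_smul,
      Matrix.smul_mulVec, smul_eq_zero_iff_right hτ, ← Matrix.mul_assoc, ← Matrix.mul_assoc,
      ← Matrix.mulVec_mulVec, ← Matrix.mulVec_mulVec] at h1
    exact Matrix.eq_zero_of_mulVec_eq_zero hD (hU (by rw [h1, Matrix.mulVec_zero]))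
  refine ⟨hV, ?_⟩
  rwa [Matrix.add_mulVec, Matrix.smul_mulVec, ← Matrix.mulVec_mulVec, hV, Matrix.mulVec_zero,
    smul_zero, add_zero] at hz

theorem norm_apply_inr_eq_nullCoord {n k : ℕ} {X : Matrix (Fin n) (Fin k ⊕ Unit) 𝕜}
    {Q : Matrix (Fin n) (Fin k) 𝕜} (hX : X.conjTranspose * X = 1)
    (hQ : Function.Injective (X.conjTranspose * Q).mulVec) {z : Fin n → 𝕜}
    (hz : ‖WithLp.toLp 2 z‖ = 1) (hXz : z = X.mulVec (X.conjTranspose.mulVec z))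
    (hQz : Q.conjTranspose.mulVec z = 0) :
    ‖X.conjTranspose.mulVec z (Sum.inr ())‖ =
      nullCoord X Q (EuclideanSpace.single (Sum.inr ()) 1) := by
  rw [nullCoord_eq (det_conjTranspose_mul_self_ne_zero hQ)
    (c := WithLp.toLp 2 (X.conjTranspose.mulVec z)) ?_ ?_]
  · simp [EuclideanSpace.inner_single_right]
  · rw [← norm_mulVec_of_conjTranspose_mul_self hX, ← hXz, hz]
  · rw [Matrix.conjTranspose_mul, Matrix.conjTranspose_conjTranspose, ← Matrix.mulVec_mulVec,
      ← hXz, hQz]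

theorem appendCol_mulVec [Fintype m] (M : Matrix l m 𝕜) (v : l → 𝕜) (c : m ⊕ Unit → 𝕜) :
    (appendCol M v).mulVec c = M.mulVec (c ∘ Sum.inl) + c (Sum.inr ()) • v := by
  ext i
  simp [appendCol, Matrix.mulVec, dotProduct, mul_comm]

end Kernels

namespace SimpleEigenvalueData

/-- For `k = 0` the normal rank `n` would be attained at some `ζ`, making `A - ζB` invertible
against singularity. -/
theorem one_le {𝕜 : Type*} [RCLike 𝕜] {n k : ℕ} (E : SimpleEigenvalueData 𝕜 n k) : 1 ≤ k := by
  by_contra! hk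
  have hbdd : BddAbove (Set.range fun ζ : ℂ => (toC E.A - ζ • toC E.B).rank) :=
    ⟨n, by rintro _ ⟨ζ, rfl⟩; simpa using Matrix.rank_le_width (toC E.A - ζ • toC E.B)⟩
  obtain ⟨ζ, hζ⟩ := Nat.sSup_mem (Set.range_nonempty _) hbdd
  have h1 := E.normalRank_eq
  have h2 : (toC E.A - ζ • toC E.B).rank = normalRank (toC E.A) (toC E.B) := hζ
  have h3 : (toC E.A - ζ • toC E.B).rank = Fintype.card (Fin n) := by
    rw [Fintype.card_fin]; omega
  have h4 : IsUnit (toC E.A - ζ • toC E.B) := by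
    rw [← Matrix.mulVec_surjective_iff_isUnit]
    have : LinearMap.range (toC E.A - ζ • toC E.B).mulVecLin = ⊤ :=
      Submodule.eq_top_of_finrank_eq (by
        rw [Module.finrank_fintype_fun_eq_card]; exact h3)
    exact LinearMap.range_eq_top.1 this
  exact (Matrix.isUnit_iff_isUnit_det _).1 h4 |>.ne_zero (E.singular ζ)

end SimpleEigenvalueData

/-! ### Almost sure structure of the eigenvectors of the modified pencil -/

namespace RandomModification

variable {𝕜 : Type*} [RCLike 𝕜] {n k : ℕ} {E : SimpleEigenvalueData 𝕜 n k}
  {Ω : Type*} [MeasurableSpace Ω] {μ : Measure Ω}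

theorem ae_eigenvectors (S : RandomModification E μ) :
    ∀ᵐ ω ∂μ, (E.A - E.lam • E.B).mulVec (S.xi ω) = 0 ∧
      (E.A - E.lam • E.B).conjTranspose.mulVec (S.yi ω) = 0 ∧
      (S.V ω).conjTranspose.mulVec (S.xi ω) = 0 ∧ (S.U ω).conjTranspose.mulVec (S.yi ω) = 0 := by
  have hMX : (E.A - E.lam • E.B) * appendCol E.X₁ E.x = 0 :=
    mul_eq_zero_of_range_toC_le E.range_X.le
  have hMY : (E.A - E.lam • E.B).conjTranspose * appendCol E.Y₁ E.y = 0 :=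
    mul_eq_zero_of_range_toC_le (by rw [toC_conjTranspose]; exact E.range_Y.le)
  have hYM : (appendCol E.Y₁ E.y).conjTranspose * (E.A - E.lam • E.B) = 0 := by
    rw [← Matrix.conjTranspose_conjTranspose (E.A - E.lam • E.B), ← Matrix.conjTranspose_mul, hMY,
      Matrix.conjTranspose_zero]
  have hXM : (appendCol E.X₁ E.x).conjTranspose * (E.A - E.lam • E.B).conjTranspose = 0 := by
    rw [← Matrix.conjTranspose_mul, hMX, Matrix.conjTranspose_zero]
  filter_upwards [ae_of_ae_map S.measurable_U.aemeasurable
      (S.uniform_U.ae_injective E.orthonormal_Y),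
    ae_of_ae_map S.measurable_V.aemeasurable (S.uniform_V.ae_injective E.orthonormal_X),
    S.generic_D, S.eigen_xi, S.eigen_yi] with ω hU hV hD hx hy
  have hsum : (E.A + S.τ • (S.U ω * Matrix.diagonal (S.dA ω) * (S.V ω).conjTranspose)) -
      E.lam • (E.B + S.τ • (S.U ω * Matrix.diagonal (S.dB ω) * (S.V ω).conjTranspose)) =
      (E.A - E.lam • E.B) + S.τ • (S.U ω * (Matrix.diagonal (S.dA ω) -
        E.lam • Matrix.diagonal (S.dB ω)) * (S.V ω).conjTranspose) := by
    simp only [Matrix.mul_sub, Matrix.sub_mul, smul_sub, smul_add, Matrix.mul_smul,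
      Matrix.smul_mul, smul_comm S.τ E.lam]
    abel
  rw [hsum] at hx hy
  obtain ⟨hx1, hx2⟩ := mulVec_eq_zero_of_add_mulVec_eq_zero hYM hU hD S.τ_ne_zero hx
  -- The adjoint equation has the same shape, with `U` and `V`, and `X` and `Y`, exchanged.
  have hy' := congrArg star hy
  rw [Matrix.star_vecMul, star_star, star_zero, Matrix.conjTranspose_add, Matrix.conjTranspose_smul,
    Matrix.conjTranspose_mul, Matrix.conjTranspose_mul, Matrix.conjTranspose_conjTranspose,
    ← Matrix.mul_assoc] at hy'
  obtain ⟨hy1, hy2⟩ := mulVec_eq_zero_of_add_mulVec_eq_zero hXM hV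
    (by rw [Matrix.det_conjTranspose]; exact star_ne_zero.2 hD) (star_ne_zero.2 S.τ_ne_zero) hy'
  exact ⟨hx2, hy2, hx1, hy1⟩

theorem ae_xi_eq (S : RandomModification E μ) : ∀ᵐ ω ∂μ, S.xi ω =
    (appendCol E.X₁ E.x).mulVec ((appendCol E.X₁ E.x).conjTranspose.mulVec (S.xi ω)) :=
  S.ae_eigenvectors.mono fun _ h => eq_mulVec_of_ker_toC_le_range E.orthonormal_X E.range_X.ge h.1

theorem ae_yi_eq (S : RandomModification E μ) : ∀ᵐ ω ∂μ, S.yi ω =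
    (appendCol E.Y₁ E.y).mulVec ((appendCol E.Y₁ E.y).conjTranspose.mulVec (S.yi ω)) :=
  S.ae_eigenvectors.mono fun _ h => eq_mulVec_of_ker_toC_le_range
    (M := (E.A - E.lam • E.B).conjTranspose) E.orthonormal_Y
    (by rw [toC_conjTranspose]; exact E.range_Y.ge) h.2.1

theorem hasDecomposition (S : RandomModification E μ) : S.HasDecomposition := by
  filter_upwards [S.ae_eigenvectors, S.ae_xi_eq, S.ae_yi_eq] with ω h hx hy
  refine ⟨⟨_, hx.trans (appendCol_mulVec _ _ _)⟩, ⟨_, hy.trans (appendCol_mulVec _ _ _)⟩,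
    h.2.2.1, h.2.2.2⟩

theorem ae_norm_alpha_eq (S : RandomModification E μ) :
    (fun ω => ‖S.alpha ω‖) =ᵐ[μ] fun ω => nullCoord (appendCol E.X₁ E.x) (S.V ω)
      (EuclideanSpace.single (Sum.inr ()) 1) := by
  filter_upwards [S.ae_eigenvectors, S.ae_xi_eq, S.norm_xi,
    ae_of_ae_map S.measurable_V.aemeasurable (S.uniform_V.ae_injective E.orthonormal_X)]
    with ω h hx hn hV
  exact norm_apply_inr_eq_nullCoord E.orthonormal_X hV hn hx h.2.2.1

theorem ae_norm_beta_eq (S : RandomModification E μ) :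
    (fun ω => ‖S.beta ω‖) =ᵐ[μ] fun ω => nullCoord (appendCol E.Y₁ E.y) (S.U ω)
      (EuclideanSpace.single (Sum.inr ()) 1) := by
  filter_upwards [S.ae_eigenvectors, S.ae_yi_eq, S.norm_yi,
    ae_of_ae_map S.measurable_U.aemeasurable (S.uniform_U.ae_injective E.orthonormal_Y)]
    with ω h hy hn hU
  exact norm_apply_inr_eq_nullCoord E.orthonormal_Y hU hn hy h.2.2.2

end RandomModification

/-! ### Moments of the coordinates, and their values for `ℂ` and `ℝ` -/

section Moments

variable {𝕜 : Type*} [RCLike 𝕜] {n k : ℕ} {Ω : Type*} [MeasurableSpace Ω] {μ : Measure Ω}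
  {X : Matrix (Fin n) (Fin k ⊕ Unit) 𝕜} {Q : Ω → Matrix (Fin n) (Fin k) 𝕜}

theorem integrable_nullCoord_comp [IsProbabilityMeasure μ] (hQ : Measurable Q)
    (h : IsUniformStiefel (μ.map Q)) (hX : X.conjTranspose * X = 1)
    (u : EuclideanSpace 𝕜 (Fin k ⊕ Unit)) : Integrable (fun ω => nullCoord X (Q ω) u) μ := by
  refine Integrable.of_bound
    ((measurable_nullCoord_left X u).comp hQ).aestronglyMeasurable ‖u‖ ?_
  filter_upwards [ae_of_ae_map hQ.aemeasurable (h.ae_nullCoord_eq hX)] with ω hω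
  obtain ⟨c, hc, hω⟩ := hω
  have h1 := norm_inner_le_norm (𝕜 := 𝕜) c u
  rwa [hω, norm_norm, ← one_mul ‖u‖, ← hc]

/-- The mean modulus of a coordinate of a uniform point of the unit sphere of `𝕜^(k+1)`. -/
noncomputable def sphereMean (𝕜 : Type*) [RCLike 𝕜] (k : ℕ) : ℝ :=
  Real.Gamma ((Module.finrank ℝ 𝕜 + 1) / 2) / Real.Gamma (Module.finrank ℝ 𝕜 / 2) *
    (Real.Gamma (Module.finrank ℝ 𝕜 * (k + 1) / 2) /
      Real.Gamma ((Module.finrank ℝ 𝕜 * (k + 1) + 1) / 2))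

theorem integral_nullCoord_comp (hQ : Measurable Q)
    (h : IsUniformStiefel (μ.map Q)) (hX : X.conjTranspose * X = 1) :
    ∫ ω, nullCoord X (Q ω) (EuclideanSpace.single (Sum.inr ()) 1) ∂μ = sphereMean 𝕜 k := by
  rw [← integral_map (φ := Q)
    (f := fun M => nullCoord X M (EuclideanSpace.single (Sum.inr ()) 1)) hQ.aemeasurable
    (measurable_nullCoord_left X _).aestronglyMeasurable]
  exact h.integral_nullCoord hX (by simp)

theorem RandomModification.moments [IsProbabilityMeasure μ] {E : SimpleEigenvalueData 𝕜 n k}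
    (S : RandomModification E μ) :
    Integrable (fun ω => ‖S.alpha ω‖) μ ∧ Integrable (fun ω => ‖S.beta ω‖) μ ∧
      Integrable (fun ω => ‖S.alpha ω‖ * ‖S.beta ω‖) μ ∧
      ∫ ω, ‖S.alpha ω‖ ∂μ = sphereMean 𝕜 k ∧ ∫ ω, ‖S.beta ω‖ ∂μ = sphereMean 𝕜 k ∧
      ∫ ω, ‖S.alpha ω‖ * ‖S.beta ω‖ ∂μ = sphereMean 𝕜 k ^ 2 := by
  have ha := S.ae_norm_alpha_eq
  have hb := S.ae_norm_beta_eq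
  have iα := integrable_nullCoord_comp S.measurable_V S.uniform_V E.orthonormal_X
    (EuclideanSpace.single (Sum.inr ()) 1)
  have iβ := integrable_nullCoord_comp S.measurable_U S.uniform_U E.orthonormal_Y
    (EuclideanSpace.single (Sum.inr ()) 1)
  have hind : IndepFun (fun ω => nullCoord (appendCol E.X₁ E.x) (S.V ω)
      (EuclideanSpace.single (Sum.inr ()) 1)) (fun ω => nullCoord (appendCol E.Y₁ E.y) (S.U ω)
      (EuclideanSpace.single (Sum.inr ()) 1)) μ :=
    S.indep.symm.comp (measurable_nullCoord_left _ _) (measurable_nullCoord_left _ _)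
  have hab := ha.mul hb
  refine ⟨iα.congr ha.symm, iβ.congr hb.symm, (hind.integrable_mul iα iβ).congr hab.symm, ?_, ?_,
    ?_⟩
  · rw [integral_congr_ae ha, integral_nullCoord_comp S.measurable_V S.uniform_V E.orthonormal_X]
  · rw [integral_congr_ae hb, integral_nullCoord_comp S.measurable_U S.uniform_U E.orthonormal_Y]
  · refine (integral_congr_ae hab).trans ?_
    rw [sq, hind.integral_mul_eq_mul_integral iα.aestronglyMeasurable iβ.aestronglyMeasurable,
      integral_nullCoord_comp S.measurable_V S.uniform_V E.orthonormal_X,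
      integral_nullCoord_comp S.measurable_U S.uniform_U E.orthonormal_Y]

theorem sphereMean_complex (k : ℕ) : sphereMean ℂ k =
    √Real.pi * Real.Gamma ((k : ℝ) + 1) / (2 * Real.Gamma ((k : ℝ) + 3 / 2)) := by
  have h1 : Real.Gamma (3 / 2) = √Real.pi / 2 := by
    rw [show (3 / 2 : ℝ) = 1 / 2 + 1 by norm_num, Real.Gamma_add_one (by norm_num),
      Real.Gamma_one_half_eq]
    ring
  rw [sphereMean, Complex.finrank_real_complex]
  push_cast
  rw [show ((2 : ℝ) + 1) / 2 = 3 / 2 by norm_num, h1, div_self two_ne_zero, Real.Gamma_one,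
    show (2 : ℝ) * (k + 1) / 2 = k + 1 by ring, show ((2 : ℝ) * (k + 1) + 1) / 2 = k + 3 / 2 by ring]
  ring

theorem sphereMean_real (k : ℕ) : sphereMean ℝ k =
    Real.Gamma (((k : ℝ) + 1) / 2) / (√Real.pi * Real.Gamma (((k : ℝ) + 2) / 2)) := by
  rw [sphereMean, Module.finrank_self]
  push_cast
  rw [show ((1 : ℝ) + 1) / 2 = 1 by norm_num, Real.Gamma_one, Real.Gamma_one_half_eq, one_mul,
    show (k : ℝ) + 1 + 1 = k + 2 by ring]
  ring

end Moments

end SingularPencil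

theorem lemma4p6 {Ω : Type*} [MeasurableSpace Ω] (μ : MeasureTheory.Measure Ω)
    [MeasureTheory.IsProbabilityMeasure μ] (n k : ℕ) :
    -- complex case
    (∀ (E : SingularPencil.SimpleEigenvalueData ℂ n k)
        (S : SingularPencil.RandomModification E μ),
      S.HasDecomposition ∧
      MeasureTheory.Integrable (fun ω => ‖S.alpha ω‖) μ ∧
      MeasureTheory.Integrable (fun ω => ‖S.beta ω‖) μ ∧
      MeasureTheory.Integrable (fun ω => ‖S.alpha ω‖ * ‖S.beta ω‖) μ ∧
      ∫ ω, ‖S.alpha ω‖ ∂μ =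
        √Real.pi * Real.Gamma ((k : ℝ) + 1) / (2 * Real.Gamma ((k : ℝ) + 3 / 2)) ∧
      ∫ ω, ‖S.beta ω‖ ∂μ =
        √Real.pi * Real.Gamma ((k : ℝ) + 1) / (2 * Real.Gamma ((k : ℝ) + 3 / 2)) ∧
      ∫ ω, ‖S.alpha ω‖ * ‖S.beta ω‖ ∂μ =
        Real.pi * Real.Gamma ((k : ℝ) + 1) ^ 2 / (4 * Real.Gamma ((k : ℝ) + 3 / 2) ^ 2) ∧
      Real.pi / (4 * ((k : ℝ) + 1)) ≤ ∫ ω, ‖S.alpha ω‖ * ‖S.beta ω‖ ∂μ ∧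
      ∫ ω, ‖S.alpha ω‖ * ‖S.beta ω‖ ∂μ ≤ Real.pi / (4 * ((k : ℝ) + 1 / 2))) ∧
    -- real case
    (∀ (E : SingularPencil.SimpleEigenvalueData ℝ n k)
        (S : SingularPencil.RandomModification E μ),
      S.HasDecomposition ∧
      MeasureTheory.Integrable (fun ω => ‖S.alpha ω‖) μ ∧
      MeasureTheory.Integrable (fun ω => ‖S.beta ω‖) μ ∧
      MeasureTheory.Integrable (fun ω => ‖S.alpha ω‖ * ‖S.beta ω‖) μ ∧
      ∫ ω, ‖S.alpha ω‖ ∂μ =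
        Real.Gamma (((k : ℝ) + 1) / 2) / (√Real.pi * Real.Gamma (((k : ℝ) + 2) / 2)) ∧
      ∫ ω, ‖S.beta ω‖ ∂μ =
        Real.Gamma (((k : ℝ) + 1) / 2) / (√Real.pi * Real.Gamma (((k : ℝ) + 2) / 2)) ∧
      ∫ ω, ‖S.alpha ω‖ * ‖S.beta ω‖ ∂μ =
        Real.Gamma (((k : ℝ) + 1) / 2) ^ 2 / (Real.pi * Real.Gamma (((k : ℝ) + 2) / 2) ^ 2) ∧
      2 / (Real.pi * ((k : ℝ) + 1)) ≤ ∫ ω, ‖S.alpha ω‖ * ‖S.beta ω‖ ∂μ ∧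
      ∫ ω, ‖S.alpha ω‖ * ‖S.beta ω‖ ∂μ ≤ 2 / (Real.pi * (k : ℝ))) := by
  open SingularPencil in
  refine ⟨fun E S => ?_, fun E S => ?_⟩
  · obtain ⟨i1, i2, i3, e1, e2, e3⟩ := S.moments
    have hsq : sphereMean ℂ k ^ 2 =
        Real.pi * Real.Gamma ((k : ℝ) + 1) ^ 2 / (4 * Real.Gamma ((k : ℝ) + 3 / 2) ^ 2) := by
      rw [sphereMean_complex, div_pow, mul_pow, mul_pow, Real.sq_sqrt Real.pi_pos.le]
      norm_num
    have hk : (0 : ℝ) ≤ k := Nat.cast_nonneg k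
    -- With `s = k + 1` the Gamma ratio is exactly the one in the squared mean.
    have h1 := one_div_le_sq_Gamma_ratio (s := k + 1) (by linarith)
    have h2 := sq_Gamma_ratio_le_one_div (s := k + 1) (by linarith)
    rw [show (k : ℝ) + 1 + 1 / 2 = k + 3 / 2 by ring] at h1 h2
    rw [show (k : ℝ) + 1 - 1 / 2 = k + 1 / 2 by ring] at h2
    have hpi : 0 ≤ Real.pi / 4 := by positivity
    have hs : Real.pi * Real.Gamma ((k : ℝ) + 1) ^ 2 / (4 * Real.Gamma ((k : ℝ) + 3 / 2) ^ 2) =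
        Real.pi / 4 * (Real.Gamma ((k : ℝ) + 1) ^ 2 / Real.Gamma ((k : ℝ) + 3 / 2) ^ 2) :=
      mul_div_mul_comm _ _ _ _
    refine ⟨S.hasDecomposition, i1, i2, i3, e1.trans (sphereMean_complex k),
      e2.trans (sphereMean_complex k), e3.trans hsq, ?_, ?_⟩
    · rw [e3, hsq, hs, ← div_div, div_eq_mul_one_div (Real.pi / 4)]
      exact mul_le_mul_of_nonneg_left h1 hpi
    · rw [e3, hsq, hs, ← div_div, div_eq_mul_one_div (Real.pi / 4) ((k : ℝ) + 1 / 2)]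
      exact mul_le_mul_of_nonneg_left h2 hpi
  · obtain ⟨i1, i2, i3, e1, e2, e3⟩ := S.moments
    have hsq : sphereMean ℝ k ^ 2 =
        Real.Gamma (((k : ℝ) + 1) / 2) ^ 2 / (Real.pi * Real.Gamma (((k : ℝ) + 2) / 2) ^ 2) := by
      rw [sphereMean_real, div_pow, mul_pow, Real.sq_sqrt Real.pi_pos.le]
    -- Needed because the upper Gamma bound at `s = (k + 1) / 2` requires `s > 1/2`.
    have hk : (1 : ℝ) ≤ k := Nat.one_le_cast.2 E.one_le
    have h1 := one_div_le_sq_Gamma_ratio (s := ((k : ℝ) + 1) / 2) (by linarith)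
    have h2 := sq_Gamma_ratio_le_one_div (s := ((k : ℝ) + 1) / 2) (by linarith)
    rw [show ((k : ℝ) + 1) / 2 + 1 / 2 = (k + 2) / 2 by ring] at h1 h2
    rw [show ((k : ℝ) + 1) / 2 - 1 / 2 = k / 2 by ring] at h2
    have hpi : 0 ≤ 1 / Real.pi := by positivity
    have hs : Real.Gamma (((k : ℝ) + 1) / 2) ^ 2 / (Real.pi * Real.Gamma (((k : ℝ) + 2) / 2) ^ 2) =
        1 / Real.pi * (Real.Gamma (((k : ℝ) + 1) / 2) ^ 2 / Real.Gamma (((k : ℝ) + 2) / 2) ^ 2) := by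
      rw [div_mul_div_comm, one_mul]
    refine ⟨S.hasDecomposition, i1, i2, i3, e1.trans (sphereMean_real k),
      e2.trans (sphereMean_real k), e3.trans hsq, ?_, ?_⟩
    · rw [e3, hsq, hs]
      refine le_trans (le_of_eq ?_) (mul_le_mul_of_nonneg_left h1 hpi)
      field_simp
    · rw [e3, hsq, hs]
      refine (mul_le_mul_of_nonneg_left h2 hpi).trans (le_of_eq ?_)
      field_simp
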